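/- Let $\delta>0$. For each $n\ge 0$ let $P_n$ be the transition matrix of an irreducible discrete-time birth-and-death chain on $\{0,\dots,m_n\}$ (so $P_n(x,y)=0$ whenever $|x-y|>1$) which is $\delta$-lazy, i.e. $P_n(x,x)\ge\delta$ for all $x$, and let $\pi_n$ be its stationary distribution. Put $d_n(t)=\max_x\|P_n^t(x,\cdot)-\pi_n\|_{\mathrm{TV}}$ and $t_{\mathrm{mix}}^{(n)}(\varepsilon)=\min\{t\in\{0,1,2,\dots\}: d_n(t)\le\varepsilon\}$. Let $\lambda_n$ be the largest absolute value of the nontrivial eigenvalues of $P_n$, i.e. those different from $1$ (with $\lambda_n=0$ if there are none, which happens only if $m_n=0$), and put $t_{\mathrm{rel}}^{(n)}=1/(1-\lambda_n)$. The family exhibits cutoff if $\lim_{n\to\infty}t_{\mathrm{mix}}^{(n)}(\varepsilon)/t_{\mathrm{mix}}^{(n)}(1-\varepsilon)=1$ for every $0<\varepsilon<1$ (in particular the denominators are nonzero for all large $n$). A sequence $w_n$ is a cutoff window if $w_n=o\big(t_{\mathrm{mix}}^{(n)}(1/4)\big)$ and for every $0<\varepsilon<1$ there is $c_\varepsilon>0$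 such that $t_{\mathrm{mix}}^{(n)}(\varepsilon)-t_{\mathrm{mix}}^{(n)}(1-\varepsilon)\le c_\varepsilon w_n$ for all $n$. Theorem. The family exhibits cutoff if and only if $t_{\mathrm{rel}}^{(n)}=o\big(t_{\mathrm{mix}}^{(n)}(1/4)\big)$. Moreover, if it exhibits cutoff, then $w_n=\sqrt{t_{\mathrm{mix}}^{(n)}(1/4)\cdot t_{\mathrm{rel}}^{(n)}}$ is a cutoff window. -/

import Mathlib

open Filter Topology Asymptotics
open scoped Matrix

namespace MarkovCutoff

noncomputable section

/-- `P` is the transition matrix of a birth-and-death chain on `{0, …, m}`: it is row-stochastic,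
and in one step the chain moves to an adjacent state or stays in place. -/
structure IsBirthDeath {m : ℕ} (P : Matrix (Fin (m + 1)) (Fin (m + 1)) ℝ) : Prop where
  stochastic : P ∈ Matrix.rowStochastic ℝ (Fin (m + 1))
  nearest_neighbour : ∀ x y : Fin (m + 1),
    (x : ℕ) + 1 < (y : ℕ) ∨ (y : ℕ) + 1 < (x : ℕ) → P x y = 0

section Finite

variable {Ω : Type*} [Fintype Ω] [DecidableEq Ω]

/-- `P` is `δ`-lazy: every holding probability is at least `δ`. -/
def IsLazy (δ : ℝ) (P : Matrix Ω Ω ℝ) : Prop :=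
  ∀ x, δ ≤ P x x

/-- `π` is a stationary probability distribution of `P`: `π` is a probability vector
and `π P = π`. -/
def IsStationary (P : Matrix Ω Ω ℝ) (π : Ω → ℝ) : Prop :=
  π ∈ stdSimplex ℝ Ω ∧ π ᵥ* P = π

/-- Total-variation distance `½ ∑ₓ |μ(x) - ν(x)|` of two distributions on a finite set. -/
def tvDist (μ ν : Ω → ℝ) : ℝ :=
  (1 / 2) * ∑ x, |μ x - ν x|

/-- Worst-case distance to stationarity `d(t) = maxₓ ‖Pᵗ(x, ·) - π‖_TV`. -/
def worstDist (P : Matrix Ω Ω ℝ) (π : Ω → ℝ) (t : ℕ) : ℝ :=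
  ⨆ x, tvDist ((P ^ t) x) π

/-- Mixing time `t_mix(ε) = min {t : d(t) ≤ ε}`. -/
def mixingTime (P : Matrix Ω Ω ℝ) (π : Ω → ℝ) (ε : ℝ) : ℕ :=
  sInf {t : ℕ | worstDist P π t ≤ ε}

/-- The largest absolute value of a nontrivial eigenvalue of `P` (an irreducible birth-and-death
chain is reversible, so its eigenvalues are real, and `1` is a simple eigenvalue).
It is `0` if there is no nontrivial eigenvalue, that is, for the one-state chain. -/
def maxNontrivialEigenvalue (P : Matrix Ω Ω ℝ) : ℝ :=
  sSup {r : ℝ | ∃ μ : ℝ, Module.End.HasEigenvalue (Matrix.toLin' P) μ ∧ μ ≠ 1 ∧ r = |μ|}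

/-- The (absolute) spectral gap. -/
def spectralGap (P : Matrix Ω Ω ℝ) : ℝ :=
  1 - maxNontrivialEigenvalue P

/-- The relaxation time, the inverse of the spectral gap. -/
def relaxationTime (P : Matrix Ω Ω ℝ) : ℝ :=
  (spectralGap P)⁻¹

end Finite

section Family

variable {Ω : ℕ → Type*} [∀ n, Fintype (Ω n)] [∀ n, DecidableEq (Ω n)]

/-- Total-variation cutoff: `t_mix(ε) / t_mix(1 - ε) → 1` for every `0 < ε < 1`.
The real quotient with denominator `0` is `0`, so this limit can only hold if the denominators
are eventually nonzero. -/
def HasCutoff (P : ∀ n, Matrix (Ω n) (Ω n) ℝ) (π : ∀ n, Ω n → ℝ) : Prop :=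
  ∀ ε : ℝ, 0 < ε → ε < 1 →
    Tendsto (fun n => (mixingTime (P n) (π n) ε : ℝ) / (mixingTime (P n) (π n) (1 - ε) : ℝ))
      atTop (𝓝 1)

/-- `w` is a cutoff window: `w = o(t_mix(1/4))`, and for every `0 < ε < 1` there is `c > 0` with
`t_mix(ε) - t_mix(1 - ε) ≤ c w` for all members of the family. -/
def IsCutoffWindow (P : ∀ n, Matrix (Ω n) (Ω n) ℝ) (π : ∀ n, Ω n → ℝ) (w : ℕ → ℝ) : Prop :=
  (w =o[atTop] fun n => (mixingTime (P n) (π n) (1 / 4) : ℝ)) ∧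
  ∀ ε : ℝ, 0 < ε → ε < 1 → ∃ c : ℝ, 0 < c ∧ ∀ n,
    (mixingTime (P n) (π n) ε : ℝ) - (mixingTime (P n) (π n) (1 - ε) : ℝ) ≤ c * w n

end Family

end

end MarkovCutoff

/-!
Write `t_rel` for the relaxation time. A necessary condition for cutoff is `t_rel = o(t_mix)`,
because an eigenfunction of a nontrivial eigenvalue decays no faster than its eigenvalue, so
`t_mix(ε)` is at least of order `t_rel log(1/ε)` (`abs_pow_le_worstDist`). The additive constant
lost here is harmless since cutoff of lazy chains forces `t_mix → ∞`
(`HasCutoff.eventually_lt_mixingTime`).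

For the converse and the window, mixing is compared with hitting times of a state `b` in the middle
of `π`, that is, with at least a quarter of the mass on either side.

* *Hitting times are concentrated.* Let `τ_b` be the hitting time of `b` from the endpoint `0`.
  Its mean and (a bound for) its variance are explicit sums over the edges below `b`. The Poincaré
  inequality for `x ↦ E_x τ_b` bounds `E_π τ_b` by a multiple of `t_rel`
  (`sum_passageMean_mul_cumWeight_le`). It follows that `Var τ_b = O(t_rel E τ_b)` (`hitVar_le`),
  and that the way from the `ε`-quantile of `π` to `b` takes an expected time
  `O(t_rel / ε)` (`hitMean_between_le`). Chebyshev's inequality is applied without a path space,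
  through the supermartingale `hitVar + (hitMean - a)²` (`sum_mul_parabola_le`).
* *Lower bound.* Before it reaches the `ε`-quantile, the chain is far from equilibrium. Thus
  `E τ_b ≤ t_mix(1 - 2ε) + O(√(t_rel E τ_b) + t_rel)` (`hitMean_le_of_worstDist_le`).
* *Upper bound.* For a test function `g` of mean zero, an `L²` maximal inequality shows that outside
  a set of small `π`-measure `|Pᵘ g|` is small simultaneously for all `u ≥ r`, where `r` is a
  large multiple of `t_rel` (`measure_exists_large_le`). Some middle state `b` lies outside this
  set, and a chain started anywhere is mixed `r` steps after hitting `b`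
  (`IsErgodicBirthDeath.worstDist_le`). This avoids couplings, which would need a holding
  probability of at least `1/2` for the paths not to cross.

Together, `t_mix(ε) - t_mix(1 - ε) = O(√(t_mix(1/4) t_rel) + t_rel)` with a constant depending on
`δ` and `ε` only (`mixingTime_sub_le`), and everything else is asymptotics. The other endpoint is
covered by reflecting the chain.
-/

namespace MarkovCutoff

/-! ### Spectral estimates for lazy reversible chains -/

section Reversible

variable {Ω : Type*} [Fintype Ω] [DecidableEq Ω]

/-- A `δ`-lazy finite chain reversible with respect to the strictly positive distribution `π`,
whose only harmonic functions are the constants. -/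
structure IsErgodicReversible (δ : ℝ) (P : Matrix Ω Ω ℝ) (π : Ω → ℝ) : Prop where
  delta_pos : 0 < δ
  nonneg : ∀ x y, 0 ≤ P x y
  row_sum : ∀ x, ∑ y, P x y = 1
  lazy : IsLazy δ P
  pos : ∀ x, 0 < π x
  sum_one : ∑ x, π x = 1
  reversible : ∀ x y, π x * P x y = π y * P y x
  harmonic : ∀ f : Ω → ℝ, P *ᵥ f = f → ∀ x y, f x = f y

namespace IsErgodicReversible

variable {δ : ℝ} {P : Matrix Ω Ω ℝ} {π : Ω → ℝ} (hP : IsErgodicReversible δ P π)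
include hP

omit [DecidableEq Ω] in
lemma nonempty : Nonempty Ω := by
  by_contra h
  rw [not_nonempty_iff] at h
  simpa using hP.sum_one

omit [DecidableEq Ω] in
lemma delta_le_one : δ ≤ 1 := by
  obtain ⟨x⟩ := hP.nonempty
  calc δ ≤ P x x := hP.lazy x
    _ ≤ ∑ y, P x y := Finset.single_le_sum (fun y _ => hP.nonneg x y) (Finset.mem_univ x)
    _ = 1 := hP.row_sum x

omit [DecidableEq Ω] in
/-- Functions have the same `π`-mean before and after an application of `P`. -/
lemma mean_mulVec (f : Ω → ℝ) : ∑ x, π x * (P *ᵥ f) x = ∑ x, π x * f x := by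
  simp only [Matrix.mulVec, dotProduct, Finset.mul_sum]
  rw [Finset.sum_comm]
  refine Finset.sum_congr rfl fun y _ => ?_
  calc ∑ x, π x * (P x y * f y) = ∑ x, (π y * f y) * P y x :=
        Finset.sum_congr rfl fun x _ => by linear_combination f y * hP.reversible x y
    _ = π y * f y := by rw [← Finset.mul_sum, hP.row_sum, mul_one]

omit [DecidableEq Ω] in
lemma mulVec_const (c : ℝ) : P *ᵥ (fun _ => c) = fun _ => c := by
  ext x
  simp [Matrix.mulVec, dotProduct, ← Finset.sum_mul, hP.row_sum]

lemma pow_mulVec_const (c : ℝ) (t : ℕ) : (P ^ t) *ᵥ (fun _ => c) = fun _ => c := by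
  induction t with
  | zero => simp
  | succ t ih => rw [pow_succ', ← Matrix.mulVec_mulVec, ih, hP.mulVec_const]

/-- Spectral decomposition in `L²(π)`: an orthonormal basis of eigenfunctions of `P`, given by the
coefficient functionals `c i`. It comes from the symmetric matrix
`√(π x) P(x, y) / √(π y)`. -/
lemma exists_spectral_decomposition :
    ∃ (Λ : Ω → ℝ) (c : Ω → (Ω → ℝ) →ₗ[ℝ] ℝ),
      (∀ f g, ∑ i, c i f * c i g = ∑ x, π x * (f x * g x)) ∧
      (∀ i f, c i (P *ᵥ f) = Λ i * c i f) ∧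
      (∀ i, Module.End.HasEigenvalue (Matrix.toLin' P) (Λ i)) ∧
      (∀ i, Λ i = 1 → ∀ f, ∑ x, π x * f x = 0 → c i f = 0) := by
  set r : Ω → ℝ := fun x => √(π x) with hr
  have r0 : ∀ x, 0 < r x := fun x => Real.sqrt_pos.2 (hP.pos x)
  have r2 : ∀ x, r x * r x = π x := fun x => Real.mul_self_sqrt (hP.pos x).le
  set A : Matrix Ω Ω ℝ := Matrix.of fun x y => r x * P x y / r y with hA
  have hAs : ∀ x y, A x y = A y x := by
    intro x y
    simp only [hA, Matrix.of_apply]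
    rw [div_eq_div_iff (r0 y).ne' (r0 x).ne']
    linear_combination hP.reversible x y + P x y * r2 x - P y x * r2 y
  have hAh : A.IsHermitian := by
    ext x y
    simp [Matrix.conjTranspose_apply, hAs x y]
  set v := hAh.eigenvectorBasis with hv
  set Λ := hAh.eigenvalues with hΛ
  have hAv : ∀ i x, ∑ y, A x y * v i y = Λ i * v i x := by
    intro i x
    have := congrFun (hAh.mulVec_eigenvectorBasis i) x
    simpa [Matrix.mulVec, dotProduct] using this
  let c : Ω → (Ω → ℝ) →ₗ[ℝ] ℝ := fun i =>
    { toFun := fun f => ∑ x, v i x * (r x * f x)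
      map_add' := fun f g => by simp [mul_add, Finset.sum_add_distrib]
      map_smul' := fun a f => by
        simp only [Pi.smul_apply, smul_eq_mul, RingHom.id_apply, Finset.mul_sum]
        exact Finset.sum_congr rfl fun x _ => by ring }
  have hc : ∀ i f, c i f = ∑ x, v i x * (r x * f x) := fun i f => rfl
  -- the eigenfunctions of `P` itself
  set φ : Ω → Ω → ℝ := fun i x => v i x / r x with hφ
  have hφP : ∀ i, P *ᵥ φ i = Λ i • φ i := by
    intro i
    ext x
    have := hAv i x
    simp only [Matrix.mulVec, dotProduct, Pi.smul_apply, smul_eq_mul, hφ]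
    rw [← mul_div_assoc, ← this, Finset.sum_div]
    refine Finset.sum_congr rfl fun y _ => ?_
    simp only [hA, Matrix.of_apply]
    have hx := (r0 x).ne'
    field_simp
  have hφ0 : ∀ i, φ i ≠ 0 := by
    intro i h
    apply v.toBasis.ne_zero i
    ext x
    have := congrFun h x
    simp only [hφ, Pi.zero_apply, div_eq_zero_iff, (r0 x).ne', or_false] at this
    simpa using this
  refine ⟨Λ, c, ?_, ?_, ?_, ?_⟩
  · intro f g
    have := v.sum_inner_mul_inner (WithLp.toLp 2 fun x => r x * f x)
      (WithLp.toLp 2 fun x => r x * g x)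
    simp only [PiLp.inner_apply, RCLike.inner_apply, conj_trivial] at this
    simp only [hc]
    calc _ = ∑ x, r x * g x * (r x * f x) := by
          rw [← this]
          refine Finset.sum_congr rfl fun i _ => ?_
          congr 1
          exact Finset.sum_congr rfl fun i _ => by ring
      _ = _ := Finset.sum_congr rfl fun x _ => by rw [← r2 x]; ring
  · intro i f
    simp only [hc, Matrix.mulVec, dotProduct, Finset.mul_sum]
    rw [Finset.sum_comm]
    refine Finset.sum_congr rfl fun y _ => ?_
    have := hAv i y
    calc ∑ x, v i x * (r x * (P x y * f y)) = ∑ x, (A y x * v i x) * (r y * f y) := by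
          refine Finset.sum_congr rfl fun x _ => ?_
          rw [← hAs x y]
          simp only [hA, Matrix.of_apply]
          have := (r0 y).ne'
          field_simp
      _ = _ := by rw [← Finset.sum_mul, this]; ring
  · intro i
    refine Module.End.hasEigenvalue_of_hasEigenvector (x := φ i) ⟨?_, hφ0 i⟩
    rw [Module.End.mem_eigenspace_iff, Matrix.toLin'_apply, hφP]
  · intro i hi f hf
    obtain ⟨x₀⟩ := hP.nonempty
    have hconst := hP.harmonic (φ i) (by rw [hφP, hi, one_smul])
    rw [hc]
    calc ∑ x, v i x * (r x * f x) = ∑ x, φ i x₀ * (π x * f x) := by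
          refine Finset.sum_congr rfl fun x _ => ?_
          rw [hconst x₀ x, ← r2 x]
          simp only [hφ]
          have := (r0 x).ne'
          field_simp
      _ = 0 := by rw [← Finset.mul_sum, hf, mul_zero]

/-- Laziness confines the spectrum to the disc of radius `1 - δ` about `δ`. -/
lemma abs_eigenvalue_sub_le {μ : ℝ} (hμ : Module.End.HasEigenvalue (Matrix.toLin' P) μ) :
    |μ - δ| ≤ 1 - δ := by
  obtain ⟨f, hf, hf0⟩ := hμ.exists_hasEigenvector
  rw [Module.End.mem_eigenspace_iff, Matrix.toLin'_apply] at hf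
  have := hP.nonempty
  obtain ⟨x, hx⟩ := Finite.exists_max fun x => |f x|
  have hfx : 0 < |f x| := by
    obtain ⟨y, hy⟩ := Function.ne_iff.1 hf0
    exact lt_of_lt_of_le (abs_pos.2 hy) (hx y)
  have h1 : (μ - δ) * f x = ∑ y, (P x y - if x = y then δ else 0) * f y := by
    have := congrFun hf x
    simp only [Matrix.mulVec, dotProduct, Pi.smul_apply, smul_eq_mul] at this
    simp [sub_mul, Finset.sum_sub_distrib, this]
  have h0 : ∀ y, 0 ≤ P x y - if x = y then δ else 0 := by
    intro y
    split_ifs with h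
    · subst h; linarith [hP.lazy x]
    · simpa using hP.nonneg x y
  have h2 : |μ - δ| * |f x| ≤ (1 - δ) * |f x| := by
    rw [← abs_mul, h1]
    calc _ ≤ ∑ y, |(P x y - if x = y then δ else 0) * f y| := Finset.abs_sum_le_sum_abs _ _
      _ ≤ ∑ y, (P x y - if x = y then δ else 0) * |f x| := by
        refine Finset.sum_le_sum fun y _ => ?_
        rw [abs_mul, abs_of_nonneg (h0 y)]
        exact mul_le_mul_of_nonneg_left (hx y) (h0 y)
      _ = _ := by
        rw [← Finset.sum_mul, Finset.sum_sub_distrib, hP.row_sum]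
        simp
  exact le_of_mul_le_mul_right h2 hfx

lemma abs_eigenvalue_le_one {μ : ℝ} (hμ : Module.End.HasEigenvalue (Matrix.toLin' P) μ) :
    |μ| ≤ 1 := by
  have := abs_le.1 (hP.abs_eigenvalue_sub_le hμ)
  have := hP.delta_pos
  rw [abs_le]
  constructor <;> linarith

lemma abs_eigenvalue_le {μ : ℝ} (hμ : Module.End.HasEigenvalue (Matrix.toLin' P) μ)
    (h1 : μ ≠ 1) : |μ| ≤ 1 - spectralGap P := by
  rw [spectralGap, sub_sub_cancel]
  refine le_csSup ⟨1, ?_⟩ ⟨μ, hμ, h1, rfl⟩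
  rintro _ ⟨ν, hν, -, rfl⟩
  exact hP.abs_eigenvalue_le_one hν

omit hP in
lemma spectralGap_le_one : spectralGap P ≤ 1 := by
  have : 0 ≤ maxNontrivialEigenvalue P := by
    refine Real.sSup_nonneg ?_
    rintro _ ⟨ν, -, -, rfl⟩
    exact abs_nonneg ν
  rw [spectralGap]
  linarith

omit hP in
/-- The second largest absolute eigenvalue is attained, unless it is the default value `0`. -/
lemma exists_eigenvalue_of_pos (h : 0 < maxNontrivialEigenvalue P) :
    ∃ μ, Module.End.HasEigenvalue (Matrix.toLin' P) μ ∧ μ ≠ 1 ∧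
      maxNontrivialEigenvalue P = |μ| := by
  have hfin : {r : ℝ | ∃ μ : ℝ, Module.End.HasEigenvalue (Matrix.toLin' P) μ ∧ μ ≠ 1 ∧
      r = |μ|}.Finite := by
    refine ((Module.End.finite_hasEigenvalue (Matrix.toLin' P)).image abs).subset ?_
    rintro _ ⟨μ, hμ, -, rfl⟩
    exact ⟨μ, hμ, rfl⟩
  refine Set.Nonempty.csSup_mem ?_ hfin
  by_contra hne
  rw [Set.not_nonempty_iff_eq_empty] at hne
  rw [maxNontrivialEigenvalue, hne, Real.sSup_empty] at h
  exact lt_irrefl _ h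

lemma spectralGap_pos : 0 < spectralGap P := by
  rw [spectralGap, sub_pos]
  by_cases h : 0 < maxNontrivialEigenvalue P
  · obtain ⟨μ, hμ, h1, h2⟩ := exists_eigenvalue_of_pos h
    have := abs_le.1 (hP.abs_eigenvalue_sub_le hμ)
    have := hP.delta_pos
    have h3 : μ < 1 := lt_of_le_of_ne (by linarith) h1
    rw [h2, abs_lt]
    constructor <;> linarith
  · linarith

/-- **Poincaré inequality** with the absolute spectral gap. -/
lemma poincare {f : Ω → ℝ} (hf : ∑ x, π x * f x = 0) :
    spectralGap P * ∑ x, π x * (f x * f x) ≤ ∑ x, π x * (f x * (f x - (P *ᵥ f) x)) := by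
  obtain ⟨Λ, c, h1, h2, h3, h4⟩ := hP.exists_spectral_decomposition
  have e := h1 f (f - P *ᵥ f)
  simp only [Pi.sub_apply] at e
  rw [← h1, ← e, Finset.mul_sum]
  refine Finset.sum_le_sum fun i _ => ?_
  rw [map_sub, h2]
  by_cases hi : Λ i = 1
  · simp [h4 i hi f hf]
  · have := (abs_le.1 (hP.abs_eigenvalue_le (h3 i) hi)).2
    nlinarith [mul_self_nonneg (c i f)]

omit hP in
/-- `(u + 1) (1 - y) yᵘ ≤ 1`, because the left side is at most `(1 - y) (1 + y + ⋯ + yᵘ)`. -/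
lemma one_sub_mul_pow_le {y : ℝ} (h0 : 0 ≤ y) (h1 : y ≤ 1) (u : ℕ) :
    (1 - y) * y ^ u ≤ 1 / (u + 1) := by
  rw [le_div_iff₀ (by positivity)]
  have h : (u + 1) * y ^ u ≤ ∑ k ∈ Finset.range (u + 1), y ^ k := by
    calc (u + 1) * y ^ u = ∑ k ∈ Finset.range (u + 1), y ^ u := by simp
      _ ≤ _ := Finset.sum_le_sum fun k hk =>
        pow_le_pow_of_le_one h0 h1 (Nat.lt_succ_iff.1 (Finset.mem_range.1 hk))
  have h2 := mul_neg_geom_sum y (u + 1)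
  have h3 : 0 ≤ y ^ (u + 1) := by positivity
  nlinarith [mul_le_mul_of_nonneg_left h (sub_nonneg.2 h1)]

lemma abs_one_sub_mul_pow_le {μ : ℝ} (hμ : Module.End.HasEigenvalue (Matrix.toLin' P) μ)
    (u : ℕ) : |(1 - μ) * μ ^ u| ≤ 1 / (δ * (u + 1)) := by
  have hδ := hP.delta_pos
  have hδ1 := hP.delta_le_one
  have hb := abs_le.1 (hP.abs_eigenvalue_sub_le hμ)
  have hμ1 := hP.abs_eigenvalue_le_one hμ
  have key : 1 - μ ≤ (1 - |μ|) / δ := by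
    rw [le_div_iff₀ hδ]
    rcases le_or_gt 0 μ with h | h
    · rw [abs_of_nonneg h]
      nlinarith
    · rw [abs_of_neg h]
      nlinarith
  rw [abs_mul, abs_pow, abs_of_nonneg (by linarith)]
  calc (1 - μ) * |μ| ^ u ≤ (1 - |μ|) / δ * |μ| ^ u := by gcongr
    _ = ((1 - |μ|) * |μ| ^ u) / δ := by ring
    _ ≤ (1 / (u + 1)) / δ := by
      gcongr
      exact one_sub_mul_pow_le (abs_nonneg μ) hμ1 u
    _ = _ := by rw [div_div, mul_comm]

/-- `L²` decay, together with the extra decay of the time derivative, which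
reflects that the semigroup of a lazy reversible chain is analytic. -/
lemma norm_bounds {f : Ω → ℝ} (hf : ∑ x, π x * f x = 0) (hf1 : ∑ x, π x * (f x * f x) ≤ 1)
    (u : ℕ) :
    ∑ x, π x * (((P ^ u) *ᵥ f) x) ^ 2 ≤ ((1 - spectralGap P) ^ u) ^ 2 ∧
    ∑ x, π x * (((P ^ (u + 1)) *ᵥ f) x - ((P ^ u) *ᵥ f) x) ^ 2 ≤ (1 / (δ * (u + 1))) ^ 2 ∧
    ∑ x, π x * (((P ^ (u + 1)) *ᵥ f) x + ((P ^ u) *ᵥ f) x) ^ 2 ≤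
      (2 * (1 - spectralGap P) ^ u) ^ 2 := by
  obtain ⟨Λ, c, h1, h2, h3, h4⟩ := hP.exists_spectral_decomposition
  have hpow : ∀ k i, c i ((P ^ k) *ᵥ f) = Λ i ^ k * c i f := by
    intro k i
    induction k with
    | zero => simp
    | succ k ih => rw [pow_succ', ← Matrix.mulVec_mulVec, h2, ih]; ring
  have hg := hP.spectralGap_pos
  have hg1 : spectralGap P ≤ 1 := spectralGap_le_one
  rw [← h1] at hf1
  have gen : ∀ (a b : ℝ) (K : ℝ),
      (∀ i, Λ i ≠ 1 → |(a * Λ i + b) * Λ i ^ u| ≤ K) →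
      ∑ x, π x * (a * ((P ^ (u + 1)) *ᵥ f) x + b * ((P ^ u) *ᵥ f) x) ^ 2 ≤ K ^ 2 := by
    intro a b K hK
    have e := h1 (a • ((P ^ (u + 1)) *ᵥ f) + b • ((P ^ u) *ᵥ f))
      (a • ((P ^ (u + 1)) *ᵥ f) + b • ((P ^ u) *ᵥ f))
    simp only [map_add, map_smul, hpow, Pi.add_apply, Pi.smul_apply, smul_eq_mul] at e
    simp only [pow_two (_ + _ : ℝ)]
    rw [← e]
    calc _ ≤ ∑ i, K ^ 2 * (c i f * c i f) := by
          refine Finset.sum_le_sum fun i _ => ?_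
          by_cases hi : Λ i = 1
          · simp [h4 i hi f hf]
          · have := sq_le_sq' (abs_le.1 (hK i hi)).1 (abs_le.1 (hK i hi)).2
            calc _ = ((a * Λ i + b) * Λ i ^ u) ^ 2 * (c i f * c i f) := by ring
              _ ≤ _ := mul_le_mul_of_nonneg_right this (mul_self_nonneg _)
      _ = K ^ 2 * ∑ i, c i f * c i f := by rw [Finset.mul_sum]
      _ ≤ K ^ 2 := mul_le_of_le_one_right (sq_nonneg K) hf1
  have hpowle : ∀ i, Λ i ≠ 1 → |Λ i ^ u| ≤ (1 - spectralGap P) ^ u := by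
    intro i hi
    rw [abs_pow]
    exact pow_le_pow_left₀ (abs_nonneg _) (hP.abs_eigenvalue_le (h3 i) hi) u
  refine ⟨?_, ?_, ?_⟩
  · simpa using gen 0 1 _ (fun i hi => by simpa using hpowle i hi)
  · have := gen 1 (-1) (1 / (δ * (u + 1))) (fun i hi => by
      have := hP.abs_one_sub_mul_pow_le (h3 i) u
      rw [← abs_neg] at this
      convert this using 2
      ring)
    simpa [sub_eq_add_neg] using this
  · have := gen 1 1 (2 * (1 - spectralGap P) ^ u) (fun i hi => by
      rw [abs_mul]
      have h5 := hP.abs_eigenvalue_le_one (h3 i)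
      have h6 : |1 * Λ i + 1| ≤ 2 := by
        rw [abs_le] at h5 ⊢
        constructor <;> linarith
      exact mul_le_mul h6 (hpowle i hi) (abs_nonneg _) (by norm_num))
    simpa using this

/-- **Maximal inequality.** The supremum of `(Pᵘ f)²` over `r ≤ u ≤ N` is dominated by
`(Pᴺ f)²` plus the total variation of `u ↦ (Pᵘ f)²`, whose mean is small once `r` is a
large multiple of the relaxation time. -/
lemma measure_exists_large_le {f : Ω → ℝ} (hf : ∑ x, π x * f x = 0)
    (hf1 : ∑ x, π x * (f x * f x) ≤ 1) {r N : ℕ} (hrN : r ≤ N) {ε : ℝ} (hε : 0 < ε)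
    (B : Finset Ω) (hB : ∀ x ∈ B, ∃ u, r ≤ u ∧ u ≤ N ∧ ε < |((P ^ u) *ᵥ f) x|) :
    ∑ x ∈ B, π x ≤ 3 / (δ * spectralGap P * (r + 1) * ε ^ 2) := by
  have hδ := hP.delta_pos
  have hδ1 := hP.delta_le_one
  have hg := hP.spectralGap_pos
  have hg1 : spectralGap P ≤ 1 := spectralGap_le_one
  set γ := spectralGap P
  set G : ℕ → Ω → ℝ := fun u => (P ^ u) *ᵥ f with hG
  set S : Ω → ℝ := fun x =>
    G N x ^ 2 + ∑ u ∈ Finset.Ico r N, |G (u + 1) x ^ 2 - G u x ^ 2| with hS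
  have hdom : ∀ x u, r ≤ u → u ≤ N → G u x ^ 2 ≤ S x := by
    intro x u hu huN
    have e : G N x ^ 2 - G u x ^ 2 = ∑ k ∈ Finset.Ico u N, (G (k + 1) x ^ 2 - G k x ^ 2) :=
      (Finset.sum_Ico_sub (fun k => G k x ^ 2) huN).symm
    have h1 : |∑ k ∈ Finset.Ico u N, (G (k + 1) x ^ 2 - G k x ^ 2)| ≤
        ∑ k ∈ Finset.Ico r N, |G (k + 1) x ^ 2 - G k x ^ 2| :=
      (Finset.abs_sum_le_sum_abs _ _).trans (Finset.sum_le_sum_of_subset_of_nonneg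
        (Finset.Ico_subset_Ico_left hu) fun _ _ _ => abs_nonneg _)
    rw [← e] at h1
    have := (abs_le.1 h1).1
    simp only [hS]
    linarith
  have hterm : ∀ u, r ≤ u → ∑ x, π x * |G (u + 1) x ^ 2 - G u x ^ 2| ≤
      2 / (δ * (r + 1)) * (1 - γ) ^ u := by
    intro u hu
    obtain ⟨-, h2, h3⟩ := hP.norm_bounds hf hf1 u
    have cs := Finset.sum_mul_sq_le_sq_mul_sq Finset.univ
      (fun x => √(π x) * |G (u + 1) x - G u x|) (fun x => √(π x) * |G (u + 1) x + G u x|)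
    have e1 : ∀ x, (√(π x) * |G (u + 1) x - G u x|) * (√(π x) * |G (u + 1) x + G u x|) =
        π x * |G (u + 1) x ^ 2 - G u x ^ 2| := by
      intro x
      rw [sq_sub_sq, abs_mul]
      linear_combination |G (u + 1) x - G u x| * |G (u + 1) x + G u x| *
        Real.mul_self_sqrt (hP.pos x).le
    have e2 : ∀ x a, (√(π x) * |a|) ^ 2 = π x * a ^ 2 := fun x a => by
      rw [mul_pow, sq_abs, Real.sq_sqrt (hP.pos x).le]
    simp only [e1, e2] at cs
    have hpow0 : 0 ≤ (1 - γ) ^ u := pow_nonneg (by linarith) u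
    have h4 : (∑ x, π x * |G (u + 1) x ^ 2 - G u x ^ 2|) ^ 2 ≤
        (1 / (δ * (u + 1)) * (2 * (1 - γ) ^ u)) ^ 2 := by
      rw [mul_pow]
      refine cs.trans (mul_le_mul h2 h3 ?_ (sq_nonneg _))
      exact Finset.sum_nonneg fun x _ => mul_nonneg (hP.pos x).le (sq_nonneg _)
    have h5 := abs_le_of_sq_le_sq h4 (by positivity)
    refine (le_abs_self _).trans (h5.trans ?_)
    have : (1 : ℝ) / (δ * (u + 1)) ≤ 1 / (δ * (r + 1)) := by
      have : (r : ℝ) ≤ u := by exact_mod_cast hu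
      gcongr
    calc _ ≤ 1 / (δ * (r + 1)) * (2 * (1 - γ) ^ u) := by gcongr
      _ = _ := by ring
  have hgeom : γ * ∑ u ∈ Finset.Ico r N, (1 - γ) ^ u ≤ 1 := by
    have h1 : ∑ u ∈ Finset.Ico r N, (1 - γ) ^ u ≤ ∑ u ∈ Finset.range N, (1 - γ) ^ u := by
      refine Finset.sum_le_sum_of_subset_of_nonneg ?_ fun _ _ _ => pow_nonneg (by linarith) _
      intro k hk
      exact Finset.mem_range.2 (Finset.mem_Ico.1 hk).2
    have h2 := mul_neg_geom_sum (1 - γ) N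
    rw [sub_sub_cancel] at h2
    have h3 : 0 ≤ (1 - γ) ^ N := pow_nonneg (by linarith) N
    nlinarith
  have hN : ∑ x, π x * G N x ^ 2 ≤ 1 / (γ * (r + 1)) := by
    obtain ⟨h1, -, -⟩ := hP.norm_bounds hf hf1 N
    have h2 := one_sub_mul_pow_le (y := 1 - γ) (by linarith) (by linarith) N
    have h3 : 0 ≤ (1 - γ) ^ N := pow_nonneg (by linarith) N
    have h3' : (1 - γ) ^ N ≤ 1 := pow_le_one₀ (by linarith) (by linarith)
    rw [sub_sub_cancel] at h2
    have h4 : (1 : ℝ) / (N + 1) ≤ 1 / (r + 1) := by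
      have : (r : ℝ) ≤ N := by exact_mod_cast hrN
      gcongr
    refine h1.trans ?_
    rw [le_div_iff₀ (by positivity)]
    rw [le_div_iff₀ (by positivity)] at h4
    have h6 : γ * (1 - γ) ^ N * (r + 1) ≤ 1 := by
      refine le_trans ?_ h4
      gcongr
    nlinarith [mul_nonneg hg.le h3]
  have hmean : ∑ x, π x * S x ≤ 3 / (δ * γ * (r + 1)) := by
    simp only [hS, mul_add, Finset.sum_add_distrib, Finset.mul_sum]
    rw [Finset.sum_comm (s := Finset.univ)]
    calc _ ≤ 1 / (γ * (r + 1)) + ∑ u ∈ Finset.Ico r N, 2 / (δ * (r + 1)) * (1 - γ) ^ u := by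
          refine add_le_add hN (Finset.sum_le_sum fun u hu => hterm u (Finset.mem_Ico.1 hu).1)
      _ = 1 / (γ * (r + 1)) +
          2 / (δ * γ * (r + 1)) * (γ * ∑ u ∈ Finset.Ico r N, (1 - γ) ^ u) := by
        rw [← Finset.mul_sum]
        field_simp
      _ ≤ 1 / (δ * γ * (r + 1)) + 2 / (δ * γ * (r + 1)) * 1 := by
        gcongr
        exact mul_le_of_le_one_left hg.le hδ1
      _ = _ := by ring
  have hmarkov : ε ^ 2 * ∑ x ∈ B, π x ≤ ∑ x, π x * S x := by
    have hS0 : ∀ x, 0 ≤ S x := fun x => by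
      simp only [hS]
      positivity
    calc ε ^ 2 * ∑ x ∈ B, π x = ∑ x ∈ B, π x * ε ^ 2 := by
          rw [← Finset.sum_mul, mul_comm]
      _ ≤ ∑ x ∈ B, π x * S x := by
        refine Finset.sum_le_sum fun x hx => mul_le_mul_of_nonneg_left ?_ (hP.pos x).le
        obtain ⟨u, h1, h2, h3⟩ := hB x hx
        refine le_trans ?_ (hdom x u h1 h2)
        rw [← sq_abs (G u x)]
        exact pow_le_pow_left₀ hε.le h3.le 2
      _ ≤ _ := Finset.sum_le_sum_of_subset_of_nonneg (Finset.subset_univ B)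
        fun x _ _ => mul_nonneg (hP.pos x).le (hS0 x)
  have h7 := hmarkov.trans hmean
  rw [le_div_iff₀ (by positivity)] at h7 ⊢
  linarith

end IsErgodicReversible

end Reversible

/-! ### Birth-and-death chains -/

section BirthDeath

variable {m : ℕ}

/-- The probability of a step `x → x + 1`, as a function on `ℕ` (`0` for `x ≥ m`). -/
def upProb (P : Matrix (Fin (m + 1)) (Fin (m + 1)) ℝ) (x : ℕ) : ℝ :=
  if h : x + 1 < m + 1 then P ⟨x, by lia⟩ ⟨x + 1, h⟩ else 0

/-- The probability of a step `x + 1 → x`, as a function on `ℕ` (`0` for `x ≥ m`). -/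
def downProb (P : Matrix (Fin (m + 1)) (Fin (m + 1)) ℝ) (x : ℕ) : ℝ :=
  if h : x + 1 < m + 1 then P ⟨x + 1, h⟩ ⟨x, by lia⟩ else 0

/-- The vector `π` extended by `0` to `ℕ`. -/
def weight (π : Fin (m + 1) → ℝ) (x : ℕ) : ℝ :=
  if h : x < m + 1 then π ⟨x, h⟩ else 0

lemma weight_val (π : Fin (m + 1) → ℝ) (x : Fin (m + 1)) : weight π x = π x := by
  simp [weight, x.2]

lemma sum_fin_filter_lt (f : ℕ → ℝ) {b : ℕ} (hb : b ≤ m + 1) :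
    ∑ x ∈ Finset.univ.filter (fun x : Fin (m + 1) => (x : ℕ) < b), f x =
      ∑ j ∈ Finset.range b, f j := by
  rw [Finset.sum_filter, Fin.sum_univ_eq_sum_range (fun j => if j < b then f j else 0),
    ← Finset.sum_filter]
  congr 1
  ext j
  simp only [Finset.mem_filter, Finset.mem_range]
  lia

/-- One step of a birth-and-death chain, applied to a function of the state. The predecessor of
`0` does not matter: `x - 1` is only used for `x ≥ 1`. -/
lemma IsBirthDeath.sum_mul {P : Matrix (Fin (m + 1)) (Fin (m + 1)) ℝ} (hP : IsBirthDeath P)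
    (φ : ℕ → ℝ) (x : Fin (m + 1)) :
    ∑ y, P x y * φ y = φ x + upProb P x * (φ (x + 1) - φ x) +
      (if (x : ℕ) = 0 then 0 else downProb P (x - 1) * (φ (x - 1) - φ x)) := by
  have hrow := Matrix.sum_row_of_mem_rowStochastic hP.stochastic x
  have h1 : ∑ y, P x y * φ y = φ x + ∑ y, P x y * (φ y - φ x) := by
    simp only [mul_sub, Finset.sum_sub_distrib, ← Finset.sum_mul, hrow]
    ring
  have h2 : ∀ y, P x y * (φ y - φ x) =
      (if (y : ℕ) = x + 1 then upProb P x * (φ (x + 1) - φ x) else 0) +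
      (if (y : ℕ) + 1 = x then downProb P (x - 1) * (φ (x - 1) - φ x) else 0) := by
    intro y
    by_cases ha : (y : ℕ) = x + 1
    · have hx : (x : ℕ) + 1 < m + 1 := by have := y.2; lia
      have hy : y = ⟨x + 1, hx⟩ := Fin.ext ha
      rw [if_pos ha, if_neg (by lia), upProb, dif_pos hx, hy]
      simp
    · by_cases hb : (y : ℕ) + 1 = x
      · have hx : (x : ℕ) - 1 + 1 < m + 1 := by have := x.2; lia
        have hy : y = ⟨x - 1, by lia⟩ := Fin.ext (by simp; lia)
        have hx' : x = ⟨(x : ℕ) - 1 + 1, hx⟩ := Fin.ext (by simp; lia)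
        rw [if_neg ha, if_pos hb, downProb, dif_pos hx, ← hy, ← hx', hy]
        simp
      · rw [if_neg ha, if_neg hb]
        rcases lt_trichotomy (x : ℕ) y with h | h | h
        · rw [hP.nearest_neighbour x y (Or.inl (by lia))]; simp
        · rw [h]; simp
        · rw [hP.nearest_neighbour x y (Or.inr (by lia))]; simp
  rw [h1, Finset.sum_congr rfl fun y _ => h2 y, Finset.sum_add_distrib, ← add_assoc]
  congr 1
  · congr 1
    by_cases hx : (x : ℕ) + 1 < m + 1
    · have : ∀ y : Fin (m + 1), ((y : ℕ) = x + 1) = (y = ⟨x + 1, hx⟩) := fun y => by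
        simp [Fin.ext_iff]
      simp [this]
    · have : ∀ y : Fin (m + 1), ¬ ((y : ℕ) = x + 1) := fun y => by have := y.2; lia
      simp [this, upProb, hx]
  · by_cases hx : (x : ℕ) = 0
    · simp [hx]
    · have : ∀ y : Fin (m + 1), ((y : ℕ) + 1 = x) = (y = ⟨x - 1, by have := x.2; lia⟩) :=
        fun y => by rw [Fin.ext_iff]; simp; lia
      simp [this, hx]

/-- A `δ`-lazy birth-and-death chain with positive upward rates, together with its reversible
distribution. -/
structure IsErgodicBirthDeath (δ : ℝ) (P : Matrix (Fin (m + 1)) (Fin (m + 1)) ℝ)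
    (π : Fin (m + 1) → ℝ) : Prop extends IsErgodicReversible δ P π where
  birthDeath : IsBirthDeath P
  up_pos : ∀ x y : Fin (m + 1), (y : ℕ) = x + 1 → 0 < P x y

section Construction

variable {P : Matrix (Fin (m + 1)) (Fin (m + 1)) ℝ} {π : Fin (m + 1) → ℝ}

/-- If an edge `x → x + 1` were missing, the states above `x` could not be reached from `x`. -/
lemma IsBirthDeath.up_pos (hP : IsBirthDeath P) (hirr : P.IsIrreducible) (x y : Fin (m + 1))
    (hxy : (y : ℕ) = x + 1) : 0 < P x y := by
  refine lt_of_le_of_ne (hirr.nonneg x y) fun h0 => ?_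
  have key : ∀ k : ℕ, ∀ u v : Fin (m + 1), u ≤ x → x < v → (P ^ k) u v = 0 := by
    intro k
    induction k with
    | zero =>
      intro u v hu hv
      rw [pow_zero, Matrix.one_apply_ne (hu.trans_lt hv).ne]
    | succ k ih =>
      intro u v hu hv
      rw [pow_succ', Matrix.mul_apply]
      refine Finset.sum_eq_zero fun w _ => ?_
      rcases le_or_gt w x with hw | hw
      · rw [ih w v hw hv, mul_zero]
      · have : P u w = 0 := by
          rw [Fin.lt_def] at hw
          rw [Fin.le_def] at hu
          by_cases hc : (u : ℕ) + 1 < w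
          · exact hP.nearest_neighbour u w (Or.inl hc)
          · have h1 : u = x := Fin.ext (by lia)
            have h2 : w = y := Fin.ext (by lia)
            rw [h1, h2, ← h0]
        rw [this, zero_mul]
  obtain ⟨k, -, hk⟩ := (Matrix.isIrreducible_iff_exists_pow_pos hirr.nonneg).1 hirr x y
  exact hk.ne' (key k x y le_rfl (by rw [Fin.lt_def]; lia))

lemma IsBirthDeath.down_pos (hP : IsBirthDeath P) (hirr : P.IsIrreducible)
    (x y : Fin (m + 1)) (hxy : (y : ℕ) = x + 1) : 0 < P y x := by
  refine lt_of_le_of_ne (hirr.nonneg y x) fun h0 => ?_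
  have key : ∀ k : ℕ, ∀ u v : Fin (m + 1), x < u → v ≤ x → (P ^ k) u v = 0 := by
    intro k
    induction k with
    | zero =>
      intro u v hu hv
      rw [pow_zero, Matrix.one_apply_ne (hv.trans_lt hu).ne']
    | succ k ih =>
      intro u v hu hv
      rw [pow_succ', Matrix.mul_apply]
      refine Finset.sum_eq_zero fun w _ => ?_
      rcases lt_or_ge x w with hw | hw
      · rw [ih w v hw hv, mul_zero]
      · have : P u w = 0 := by
          rw [Fin.le_def] at hw
          rw [Fin.lt_def] at hu
          by_cases hc : (w : ℕ) + 1 < u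
          · exact hP.nearest_neighbour u w (Or.inr hc)
          · have h1 : w = x := Fin.ext (by lia)
            have h2 : u = y := Fin.ext (by lia)
            rw [h1, h2, ← h0]
        rw [this, zero_mul]
  obtain ⟨k, -, hk⟩ := (Matrix.isIrreducible_iff_exists_pow_pos hirr.nonneg).1 hirr y x
  exact hk.ne' (key k y x (by rw [Fin.lt_def]; lia) le_rfl)

/-- Detailed balance across an edge: in equilibrium the flow out of `{0, …, i}`
equals the flow into it. -/
lemma IsBirthDeath.detailed_balance (hP : IsBirthDeath P) (hπ : IsStationary P π)
    (x y : Fin (m + 1)) (hxy : (y : ℕ) = x + 1) : π x * P x y = π y * P y x := by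
  set φ : ℕ → ℝ := fun k => if k ≤ x then 1 else 0 with hφ
  have h1 : ∑ z, π z * ∑ w, P z w * φ w = ∑ z, π z * φ z := by
    calc _ = ∑ w, (π ᵥ* P) w * φ w := by
          simp only [Matrix.vecMul, dotProduct, Finset.mul_sum, Finset.sum_mul]
          rw [Finset.sum_comm]
          exact Finset.sum_congr rfl fun _ _ => Finset.sum_congr rfl fun _ _ => by ring
      _ = _ := by rw [hπ.2]
  have hx1 : (x : ℕ) + 1 < m + 1 := by have := y.2; lia
  have hy : y = ⟨x + 1, hx1⟩ := Fin.ext hxy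
  have h2 : ∀ z, π z * ∑ w, P z w * φ w = π z * φ z + ((if z = x then -(π x * P x y) else 0) +
      if z = y then π y * P y x else 0) := by
    intro z
    rw [hP.sum_mul φ z, mul_add, mul_add, add_assoc]
    congr 1
    congr 1
    · by_cases hz : z = x
      · subst hz
        simp [hφ, upProb, hx1, hy]
      · have hz' : (z : ℕ) ≠ x := fun h => hz (Fin.ext h)
        rw [if_neg hz]
        have : φ (z + 1) = φ z := by
          simp only [hφ]
          congr 1
          rw [eq_iff_iff]
          lia
        rw [this]
        simp
    · by_cases hz : z = y
      · have h3 : (z : ℕ) = x + 1 := by rw [hz, hxy]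
        rw [if_pos hz, if_neg (by lia)]
        simp [hφ, downProb, hx1, hz, hy]
      · have hz' : (z : ℕ) ≠ x + 1 := fun h => hz (Fin.ext (by lia))
        rw [if_neg hz]
        split_ifs with h0
        · simp
        · have : φ (z - 1) = φ z := by
            simp only [hφ]
            congr 1
            rw [eq_iff_iff]
            lia
          rw [this]
          simp
  rw [Finset.sum_congr rfl fun z _ => h2 z] at h1
  simp only [Finset.sum_add_distrib, Finset.sum_ite_eq', Finset.mem_univ, if_true] at h1
  linarith

lemma IsBirthDeath.isErgodicBirthDeath {δ : ℝ} (hδ : 0 < δ) (hP : IsBirthDeath P)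
    (hirr : P.IsIrreducible) (hlazy : IsLazy δ P) (hπ : IsStationary P π) :
    IsErgodicBirthDeath δ P π := by
  have hup := hP.up_pos hirr
  have hdown := hP.down_pos hirr
  have hdb := hP.detailed_balance hπ
  obtain ⟨hπ0, hπ1⟩ := hπ.1
  refine ⟨⟨hδ, hirr.nonneg, Matrix.sum_row_of_mem_rowStochastic hP.stochastic, hlazy, ?_, hπ1,
    ?_, ?_⟩, hP, hup⟩
  · -- a zero of `π` would propagate along the edges to all states
    have hstep : ∀ x y : Fin (m + 1), (y : ℕ) = x + 1 → (π x = 0 ↔ π y = 0) := by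
      intro x y hxy
      have h := hdb x y hxy
      constructor
      · intro h0
        rw [h0, zero_mul, eq_comm, mul_eq_zero] at h
        exact h.resolve_right (hdown x y hxy).ne'
      · intro h0
        rw [h0, zero_mul, mul_eq_zero] at h
        exact h.resolve_right (hup x y hxy).ne'
    have hall : ∀ k (hk : k < m + 1), (π ⟨k, hk⟩ = 0 ↔ π 0 = 0) := by
      intro k
      induction k with
      | zero => intro hk; rfl
      | succ k ih =>
        intro hk
        rw [← ih (by lia), hstep ⟨k, by lia⟩ ⟨k + 1, hk⟩ rfl]
    intro x
    refine lt_of_le_of_ne (hπ0 x) fun h => ?_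
    have h0 := (hall x x.2).1 h.symm
    have : ∑ x, π x = 0 := Finset.sum_eq_zero fun y _ => (hall y y.2).2 h0
    linarith
  · intro x y
    rcases lt_trichotomy (x : ℕ) y with h | h | h
    · by_cases hc : (y : ℕ) = x + 1
      · exact hdb x y hc
      · rw [hP.nearest_neighbour x y (Or.inl (by lia)),
          hP.nearest_neighbour y x (Or.inr (by lia))]
        simp
    · rw [Fin.ext h]
    · by_cases hc : (x : ℕ) = y + 1
      · exact (hdb y x hc).symm
      · rw [hP.nearest_neighbour x y (Or.inr (by lia)),
          hP.nearest_neighbour y x (Or.inl (by lia))]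
        simp
  · intro f hf
    have hf' : ∀ x : Fin (m + 1), ∑ y, P x y * weight f y = weight f x := by
      intro x
      simp only [weight_val]
      exact congrFun hf x
    have hstep : ∀ k, k + 1 < m + 1 → weight f (k + 1) = weight f k := by
      intro k
      induction k with
      | zero =>
        intro hk
        have h := hf' ⟨0, by lia⟩
        rw [hP.sum_mul] at h
        have hu : 0 < upProb P 0 := by
          rw [upProb, dif_pos hk]
          exact hup _ _ rfl
        simp only [if_true, add_zero, add_eq_left, mul_eq_zero, hu.ne', false_or] at h
        linarith
      | succ k ih =>
        intro hk
        have h := hf' ⟨k + 1, by lia⟩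
        rw [hP.sum_mul] at h
        have hu : 0 < upProb P (k + 1) := by
          rw [upProb, dif_pos hk]
          exact hup _ _ rfl
        simp only [Nat.add_sub_cancel, ih (by lia), sub_self, mul_zero, ite_self, add_zero,
          add_eq_left, mul_eq_zero, hu.ne', false_or] at h
        rw [ih (by lia)]
        linarith
    have hall : ∀ k, k < m + 1 → weight f k = weight f 0 := by
      intro k
      induction k with
      | zero => intro _; rfl
      | succ k ih => intro hk; rw [hstep k hk, ih (by lia)]
    intro x y
    rw [← weight_val f x, ← weight_val f y, hall x x.2, hall y y.2]

end Construction

/-! ### Hitting times of a higher state -/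

/-- `π{0, …, i}`. -/
def cumWeight (π : Fin (m + 1) → ℝ) (i : ℕ) : ℝ :=
  ∑ j ∈ Finset.range (i + 1), weight π j

/-- The expected passage time from `i` to `i + 1`. -/
noncomputable def passageMean (P : Matrix (Fin (m + 1)) (Fin (m + 1)) ℝ)
    (π : Fin (m + 1) → ℝ) (i : ℕ) : ℝ :=
  cumWeight π i / (weight π i * upProb P i)

/-- An upper bound for the variance of the passage time from `i` to `i + 1`. -/
noncomputable def passageVar (P : Matrix (Fin (m + 1)) (Fin (m + 1)) ℝ)
    (π : Fin (m + 1) → ℝ) (i : ℕ) : ℝ :=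
  (2 * ∑ j ∈ Finset.range i, cumWeight π j * passageMean P π j +
    cumWeight π i * passageMean P π i) / (weight π i * upProb P i)

/-- The expected hitting time of `b` from `x ≤ b` (and `0` for `x ≥ b`). -/
noncomputable def hitMean (P : Matrix (Fin (m + 1)) (Fin (m + 1)) ℝ)
    (π : Fin (m + 1) → ℝ) (b x : ℕ) : ℝ :=
  ∑ i ∈ Finset.Ico x b, passageMean P π i

/-- An upper bound for the variance of the hitting time of `b` from `x ≤ b`. -/
noncomputable def hitVar (P : Matrix (Fin (m + 1)) (Fin (m + 1)) ℝ)
    (π : Fin (m + 1) → ℝ) (b x : ℕ) : ℝ :=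
  ∑ i ∈ Finset.Ico x b, passageVar P π i

namespace IsErgodicBirthDeath

variable {δ : ℝ} {P : Matrix (Fin (m + 1)) (Fin (m + 1)) ℝ} {π : Fin (m + 1) → ℝ}
  (hP : IsErgodicBirthDeath δ P π)
include hP

lemma weight_pos {x : ℕ} (hx : x ≤ m) : 0 < weight π x := by
  rw [weight, dif_pos (by lia)]
  exact hP.pos _

lemma weight_nonneg (x : ℕ) : 0 ≤ weight π x := by
  rw [weight]
  split_ifs
  · exact (hP.pos _).le
  · exact le_rfl

lemma upProb_pos {x : ℕ} (hx : x < m) : 0 < upProb P x := by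
  rw [upProb, dif_pos (by lia)]
  exact hP.up_pos _ _ rfl

lemma weight_mul_upProb {x : ℕ} (hx : x < m) :
    weight π x * upProb P x = weight π (x + 1) * downProb P x := by
  rw [upProb, downProb, dif_pos (by lia), dif_pos (by lia), weight, weight, dif_pos (by lia),
    dif_pos (by lia)]
  exact hP.reversible _ _

lemma sum_weight : ∑ j ∈ Finset.range (m + 1), weight π j = 1 := by
  rw [← Fin.sum_univ_eq_sum_range (fun j => weight π j)]
  simp only [weight_val]
  exact hP.sum_one

lemma cumWeight_pos {i : ℕ} : 0 < cumWeight π i := by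
  rw [cumWeight, Finset.sum_range_succ']
  exact add_pos_of_nonneg_of_pos (Finset.sum_nonneg fun j _ => hP.weight_nonneg _)
    (hP.weight_pos (Nat.zero_le m))

lemma sum_range_weight_mono {a b : ℕ} (hab : a ≤ b) :
    ∑ j ∈ Finset.range a, weight π j ≤ ∑ j ∈ Finset.range b, weight π j :=
  Finset.sum_le_sum_of_subset_of_nonneg (Finset.range_mono hab) fun j _ _ => hP.weight_nonneg j

lemma sum_range_weight_le_one (b : ℕ) : ∑ j ∈ Finset.range b, weight π j ≤ 1 := by
  rcases le_total b (m + 1) with h | h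
  · exact (hP.sum_range_weight_mono h).trans hP.sum_weight.le
  · rw [← hP.sum_weight]
    refine (Finset.sum_subset (Finset.range_mono h) fun x _ hx => ?_).ge
    rw [weight, dif_neg (by simpa using hx)]

lemma passageMean_pos {i : ℕ} (hi : i < m) : 0 < passageMean P π i :=
  div_pos hP.cumWeight_pos (mul_pos (hP.weight_pos hi.le) (hP.upProb_pos hi))

lemma weight_mul_upProb_mul_passageMean {i : ℕ} (hi : i < m) :
    weight π i * upProb P i * passageMean P π i = cumWeight π i :=
  mul_div_cancel₀ _ (mul_pos (hP.weight_pos hi.le) (hP.upProb_pos hi)).ne'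

lemma passageVar_nonneg {i : ℕ} (hi : i < m) : 0 ≤ passageVar P π i := by
  refine div_nonneg ?_ (mul_pos (hP.weight_pos hi.le) (hP.upProb_pos hi)).le
  refine add_nonneg (mul_nonneg zero_le_two (Finset.sum_nonneg fun j hj => ?_)) ?_
  · have hj' : j < m := (Finset.mem_range.1 hj).trans hi
    exact mul_nonneg hP.cumWeight_pos.le (hP.passageMean_pos hj').le
  · exact mul_nonneg hP.cumWeight_pos.le (hP.passageMean_pos hi).le

lemma hitMean_nonneg {b : ℕ} (hb : b ≤ m) (x : ℕ) : 0 ≤ hitMean P π b x :=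
  Finset.sum_nonneg fun _ hi => (hP.passageMean_pos ((Finset.mem_Ico.1 hi).2.trans_le hb)).le

lemma hitVar_nonneg {b : ℕ} (hb : b ≤ m) (x : ℕ) : 0 ≤ hitVar P π b x :=
  Finset.sum_nonneg fun _ hi => hP.passageVar_nonneg ((Finset.mem_Ico.1 hi).2.trans_le hb)

lemma hitMean_antitone {b : ℕ} (hb : b ≤ m) (x : ℕ) : hitMean P π b x ≤ hitMean P π b 0 :=
  Finset.sum_le_sum_of_subset_of_nonneg (Finset.Ico_subset_Ico_left (Nat.zero_le x))
    fun _ hi _ => (hP.passageMean_pos ((Finset.mem_Ico.1 hi).2.trans_le hb)).le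

lemma hitVar_antitone {b : ℕ} (hb : b ≤ m) (x : ℕ) : hitVar P π b x ≤ hitVar P π b 0 :=
  Finset.sum_le_sum_of_subset_of_nonneg (Finset.Ico_subset_Ico_left (Nat.zero_le x))
    fun _ hi _ => hP.passageVar_nonneg ((Finset.mem_Ico.1 hi).2.trans_le hb)

omit hP in
lemma hitMean_succ {b x : ℕ} (hx : x < b) :
    hitMean P π b x = passageMean P π x + hitMean P π b (x + 1) :=
  Finset.sum_eq_sum_Ico_succ_bot hx _

omit hP in
lemma hitVar_succ {b x : ℕ} (hx : x < b) :
    hitVar P π b x = passageVar P π x + hitVar P π b (x + 1) :=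
  Finset.sum_eq_sum_Ico_succ_bot hx _

omit hP in
lemma hitMean_self (b x : ℕ) (hx : b ≤ x) : hitMean P π b x = 0 := by
  simp [hitMean, Finset.Ico_eq_empty_of_le hx]

omit hP in
lemma hitVar_self (b x : ℕ) (hx : b ≤ x) : hitVar P π b x = 0 := by
  simp [hitVar, Finset.Ico_eq_empty_of_le hx]

/-- Balance equation for the expected passage times. -/
lemma upProb_mul_passageMean_succ {x : ℕ} (hx : x + 1 < m) :
    upProb P (x + 1) * passageMean P π (x + 1) = 1 + downProb P x * passageMean P π x := by
  have h1 := hP.weight_mul_upProb_mul_passageMean hx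
  have h2 := hP.weight_mul_upProb_mul_passageMean (i := x) (by lia)
  have h3 := hP.weight_mul_upProb (x := x) (by lia)
  have h4 : cumWeight π (x + 1) = cumWeight π x + weight π (x + 1) := by
    rw [cumWeight, Finset.sum_range_succ, ← cumWeight]
  refine mul_left_cancel₀ (hP.weight_pos (x := x + 1) hx.le).ne' ?_
  rw [h3] at h2
  linear_combination h1 + h4 - h2

lemma upProb_mul_passageMean_zero (hm : 0 < m) : upProb P 0 * passageMean P π 0 = 1 := by
  have h1 := hP.weight_mul_upProb_mul_passageMean hm
  have h4 : cumWeight π 0 = weight π 0 := by simp [cumWeight]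
  refine mul_left_cancel₀ (hP.weight_pos (x := 0) hm.le).ne' ?_
  linear_combination h1 + h4

/-- The bounds on the variances are chosen so that the law of total variance holds as an
inequality. -/
lemma upProb_mul_passageVar_succ {x : ℕ} (hx : x + 1 < m) :
    downProb P x * passageVar P π x + upProb P (x + 1) * passageMean P π (x + 1) ^ 2 +
      downProb P x * passageMean P π x ^ 2 =
      upProb P (x + 1) * passageVar P π (x + 1) := by
  have h1 := hP.weight_mul_upProb_mul_passageMean hx
  have h2 := hP.weight_mul_upProb_mul_passageMean (i := x) (by lia)
  have h3 := hP.weight_mul_upProb (x := x) (by lia)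
  have hc1 := (mul_pos (hP.weight_pos hx.le) (hP.upProb_pos hx)).ne'
  have hc2 := (mul_pos (hP.weight_pos (x := x) (by lia)) (hP.upProb_pos (x := x) (by lia))).ne'
  have h5 : weight π (x + 1) * upProb P (x + 1) * passageVar P π (x + 1) =
      2 * ∑ j ∈ Finset.range (x + 1), cumWeight π j * passageMean P π j +
        cumWeight π (x + 1) * passageMean P π (x + 1) := mul_div_cancel₀ _ hc1
  have h6 : weight π x * upProb P x * passageVar P π x =
      2 * ∑ j ∈ Finset.range x, cumWeight π j * passageMean P π j +
        cumWeight π x * passageMean P π x := mul_div_cancel₀ _ hc2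
  rw [Finset.sum_range_succ] at h5
  rw [h3] at h2 h6
  refine mul_left_cancel₀ (hP.weight_pos (x := x + 1) hx.le).ne' ?_
  linear_combination h6 - h5 + passageMean P π (x + 1) * h1 + passageMean P π x * h2

lemma upProb_mul_passageVar_zero (hm : 0 < m) :
    upProb P 0 * passageMean P π 0 ^ 2 = upProb P 0 * passageVar P π 0 := by
  have h1 := hP.weight_mul_upProb_mul_passageMean hm
  have hc := (mul_pos (hP.weight_pos hm.le) (hP.upProb_pos hm)).ne'
  have h5 : weight π 0 * upProb P 0 * passageVar P π 0 =
      2 * ∑ j ∈ Finset.range 0, cumWeight π j * passageMean P π j +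
        cumWeight π 0 * passageMean P π 0 := mul_div_cancel₀ _ hc
  rw [Finset.sum_range_zero] at h5
  refine mul_left_cancel₀ (hP.weight_pos (x := 0) hm.le).ne' ?_
  linear_combination passageMean P π 0 * h1 - h5

/-- Below `b`, the expected hitting time decreases by one in each step. -/
lemma sum_mul_hitMean {b : ℕ} (hb : b ≤ m) (x : Fin (m + 1)) (hx : (x : ℕ) < b) :
    ∑ y, P x y * hitMean P π b y = hitMean P π b x - 1 := by
  rw [hP.birthDeath.sum_mul (hitMean P π b)]
  obtain ⟨x, hxm⟩ := x
  simp only at hx ⊢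
  have h1 := hitMean_succ (P := P) (π := π) hx
  rcases x with _ | x
  · have := hP.upProb_mul_passageMean_zero (by lia)
    simp only [if_true]
    linear_combination -this - upProb P 0 * h1
  · have := hP.upProb_mul_passageMean_succ (x := x) (by lia)
    have h2 := hitMean_succ (P := P) (π := π) (b := b) (x := x) (by lia)
    rw [if_neg (by lia), Nat.add_sub_cancel]
    linear_combination -this - upProb P (x + 1) * h1 + downProb P x * h2

/-- If `τ` is the hitting time of `b`, then `hitVar b x + (hitMean b x - a)²` bounds
`E_x[(τ - a)²]`; this is its supermartingale property. -/
lemma sum_mul_parabola_le {b : ℕ} (hb : b ≤ m) (x : Fin (m + 1)) (hx : (x : ℕ) < b) (a : ℝ) :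
    ∑ y, P x y * (hitVar P π b y + (hitMean P π b y - (a - 1)) ^ 2) ≤
      hitVar P π b x + (hitMean P π b x - a) ^ 2 := by
  rw [hP.birthDeath.sum_mul (fun y => hitVar P π b y + (hitMean P π b y - (a - 1)) ^ 2)]
  obtain ⟨x, hxm⟩ := x
  simp only at hx ⊢
  have h1 := hitMean_succ (P := P) (π := π) hx
  have h1' := hitVar_succ (P := P) (π := π) hx
  have e1 : hitMean P π b (x + 1) = hitMean P π b x - passageMean P π x := by linarith
  have e1' : hitVar P π b (x + 1) = hitVar P π b x - passageVar P π x := by linarith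
  rw [e1, e1']
  rcases x with _ | x
  · have h3 := hP.upProb_mul_passageMean_zero (by lia)
    have h4 := hP.upProb_mul_passageVar_zero (by lia)
    simp only [if_true]
    refine le_of_add_le_of_nonneg_left (b := 1) (le_of_eq ?_) zero_le_one
    linear_combination -2 * (hitMean P π b 0 - (a - 1)) * h3 + h4
  · have h3 := hP.upProb_mul_passageMean_succ (x := x) (by lia)
    have h4 := hP.upProb_mul_passageVar_succ (x := x) (by lia)
    have h2 := hitMean_succ (P := P) (π := π) (b := b) (x := x) (by lia)
    have h2' := hitVar_succ (P := P) (π := π) (b := b) (x := x) (by lia)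
    rw [if_neg (by lia), Nat.add_sub_cancel, h2, h2']
    refine le_of_add_le_of_nonneg_left (b := 1) (le_of_eq ?_) zero_le_one
    linear_combination -2 * (hitMean P π b (x + 1) - (a - 1)) * h3 + h4

end IsErgodicBirthDeath

end BirthDeath

/-! ### Tails of hitting times and distance to equilibrium -/

section BirthDeathTails

variable {m : ℕ}

namespace IsErgodicBirthDeath

variable {δ : ℝ} {P : Matrix (Fin (m + 1)) (Fin (m + 1)) ℝ} {π : Fin (m + 1) → ℝ}
  (hP : IsErgodicBirthDeath δ P π)
include hP

lemma abs_pow_mulVec_le {f : Fin (m + 1) → ℝ} {C : ℝ} (hf : ∀ x, |f x| ≤ C) (t : ℕ)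
    (x : Fin (m + 1)) : |((P ^ t) *ᵥ f) x| ≤ C := by
  induction t generalizing x with
  | zero => simpa using hf x
  | succ t ih =>
    rw [pow_succ', ← Matrix.mulVec_mulVec, Matrix.mulVec, dotProduct]
    calc _ ≤ ∑ y, |P x y * ((P ^ t) *ᵥ f) y| := Finset.abs_sum_le_sum_abs _ _
      _ ≤ ∑ y, P x y * C := Finset.sum_le_sum fun y _ => by
        rw [abs_mul, abs_of_nonneg (hP.nonneg x y)]
        exact mul_le_mul_of_nonneg_left (ih y) (hP.nonneg x y)
      _ = C := by rw [← Finset.sum_mul, hP.row_sum, one_mul]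

/-- Chebyshev bound for early arrival: by time `t` the chain is rarely at or above `b`. -/
lemma lower_tail {b : ℕ} (hb : b ≤ m) (t : ℕ) (x : Fin (m + 1)) {a : ℝ} (ha : t ≤ a) :
    ((P ^ t) *ᵥ fun y : Fin (m + 1) => if b ≤ (y : ℕ) then 1 else 0) x * (a - t) ^ 2 ≤
      hitVar P π b x + (hitMean P π b x - a) ^ 2 := by
  have hbase : ∀ (t : ℕ) (x : Fin (m + 1)) (a : ℝ), t ≤ a → b ≤ (x : ℕ) →
      ((P ^ t) *ᵥ fun y : Fin (m + 1) => if b ≤ (y : ℕ) then 1 else 0) x * (a - t) ^ 2 ≤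
      hitVar P π b x + (hitMean P π b x - a) ^ 2 := by
    intro t x a ha hx
    have h1 := (abs_le.1 (hP.abs_pow_mulVec_le (C := 1)
      (f := fun y : Fin (m + 1) => if b ≤ (y : ℕ) then 1 else 0)
      (fun y => by split_ifs <;> simp) t x)).2
    rw [hitMean_self b x hx, hitVar_self b x hx]
    have h2 : (0 : ℝ) ≤ t := Nat.cast_nonneg t
    have h3 : (a - t) ^ 2 ≤ a ^ 2 := pow_le_pow_left₀ (by linarith) (by linarith) 2
    calc _ ≤ 1 * (a - t) ^ 2 := mul_le_mul_of_nonneg_right h1 (sq_nonneg _)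
      _ ≤ _ := by linarith
  induction t generalizing x a with
  | zero =>
    by_cases hx : b ≤ (x : ℕ)
    · exact hbase 0 x a ha hx
    · simp only [pow_zero, Matrix.one_mulVec, hx, if_false, zero_mul]
      exact add_nonneg (hP.hitVar_nonneg hb x) (sq_nonneg _)
  | succ t ih =>
    by_cases hx : b ≤ (x : ℕ)
    · exact hbase (t + 1) x a ha hx
    · refine le_trans ?_ (hP.sum_mul_parabola_le hb x (by lia) a)
      rw [pow_succ', ← Matrix.mulVec_mulVec, Matrix.mulVec, dotProduct, Finset.sum_mul]
      refine Finset.sum_le_sum fun y _ => ?_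
      rw [mul_assoc]
      refine mul_le_mul_of_nonneg_left ?_ (hP.nonneg x y)
      push_cast at ha ⊢
      rw [show a - (t + 1) = a - 1 - t by ring]
      exact ih y (by linarith)

/-- Chebyshev bound for late arrival, in the form in which it is needed: the bound `ε` that a
subsolution `G` satisfies at `b` spreads to a state `x ≤ b` once the chain started at `x` has
reached `b`. -/
lemma upper_tail {b : ℕ} (hb : b ≤ m) {G : ℕ → Fin (m + 1) → ℝ} {ε : ℝ} (hε : 0 ≤ ε) {N : ℕ}
    (hG0 : ∀ y, G 0 y ≤ 1) (hGP : ∀ k y, G (k + 1) y ≤ ∑ z, P y z * G k z)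
    (hGb : ∀ k ≤ N, ∀ y : Fin (m + 1), (y : ℕ) = b → G k y ≤ ε) {s : ℕ} (hs : s ≤ N)
    (x : Fin (m + 1)) (hx : (x : ℕ) ≤ b) {a : ℝ} (ha : a ≤ s) :
    (G s x - ε) * (s - a) ^ 2 ≤ hitVar P π b x + (hitMean P π b x - a) ^ 2 := by
  have hrhs : ∀ (x : Fin (m + 1)) (a : ℝ), 0 ≤ hitVar P π b x + (hitMean P π b x - a) ^ 2 :=
    fun x a => add_nonneg (hP.hitVar_nonneg hb x) (sq_nonneg _)
  induction s generalizing x a with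
  | zero =>
    rw [Nat.cast_zero] at ha ⊢
    have h1 := hP.hitMean_nonneg hb x
    have h2 : (0 - a) ^ 2 ≤ (hitMean P π b x - a) ^ 2 :=
      pow_le_pow_left₀ (by linarith) (by linarith) 2
    have h3 : G 0 x - ε ≤ 1 := by linarith [hG0 x]
    calc _ ≤ 1 * (0 - a) ^ 2 := mul_le_mul_of_nonneg_right h3 (sq_nonneg _)
      _ ≤ _ := by linarith [hP.hitVar_nonneg hb x]
  | succ s ih =>
    rcases hx.lt_or_eq with hxb | hxb
    · refine le_trans ?_ (hP.sum_mul_parabola_le hb x hxb a)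
      calc _ ≤ (∑ y, P x y * (G s y - ε)) * ((s + 1 : ℕ) - a) ^ 2 := by
            refine mul_le_mul_of_nonneg_right ?_ (sq_nonneg _)
            simp only [mul_sub, Finset.sum_sub_distrib, ← Finset.sum_mul, hP.row_sum, one_mul]
            linarith [hGP s x]
        _ ≤ _ := by
          rw [Finset.sum_mul]
          refine Finset.sum_le_sum fun y _ => ?_
          by_cases hy : (y : ℕ) ≤ b
          · rw [mul_assoc]
            refine mul_le_mul_of_nonneg_left ?_ (hP.nonneg x y)
            push_cast at ha ⊢
            rw [show (s : ℝ) + 1 - a = s - (a - 1) by ring]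
            exact ih (by lia) y hy (by linarith)
          · rw [hP.birthDeath.nearest_neighbour x y (Or.inl (by lia))]
            simp
    · have h1 := hGb (s + 1) hs x hxb
      exact (mul_nonpos_of_nonpos_of_nonneg (by linarith) (sq_nonneg _)).trans (hrhs x a)

/-- The Poincaré inequality applied to the expected hitting time of `b`. The sum
on the left is `E_π τ_b`, where `τ_b` is `0` for a start above `b`. -/
lemma sum_passageMean_mul_cumWeight_le {b : ℕ} (hb : b ≤ m) :
    spectralGap P * (1 - ∑ j ∈ Finset.range b, weight π j) *
      ∑ i ∈ Finset.range b, passageMean P π i * cumWeight π i ≤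
      ∑ j ∈ Finset.range b, weight π j := by
  set γ := spectralGap P
  set h : Fin (m + 1) → ℝ := fun x => hitMean P π b x with hh
  set M := ∑ x, π x * h x with hM
  set S := ∑ x, π x * (h x * h x) with hS
  set F := ∑ j ∈ Finset.range b, weight π j with hF
  have hγ : 0 < γ := hP.spectralGap_pos
  have hFsum : F = ∑ x ∈ Finset.univ.filter (fun x : Fin (m + 1) => (x : ℕ) < b), π x := by
    rw [hF, ← sum_fin_filter_lt (m := m) (weight π) (by lia)]
    simp only [weight_val]
  have h0 : ∀ x : Fin (m + 1), ¬ (x : ℕ) < b → h x = 0 := fun x hx =>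
    hitMean_self b x (by lia)
  have hMsum : M = ∑ i ∈ Finset.range b, passageMean P π i * cumWeight π i := by
    have e1 : M = ∑ x ∈ Finset.range b, weight π x * hitMean P π b x := by
      rw [hM, ← sum_fin_filter_lt (m := m) (fun x => weight π x * hitMean P π b x) (by lia),
        Finset.sum_filter]
      refine Finset.sum_congr rfl fun x _ => ?_
      split_ifs with hx
      · rw [weight_val]
      · rw [h0 x hx, mul_zero]
    rw [e1]
    simp only [hitMean, cumWeight, Finset.mul_sum]
    rw [Finset.range_eq_Ico, Finset.sum_Ico_Ico_comm]
    refine Finset.sum_congr rfl fun i _ => ?_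
    rw [Finset.range_eq_Ico]
    exact Finset.sum_congr rfl fun j _ => mul_comm _ _
  have hM0 : 0 ≤ M := Finset.sum_nonneg fun x _ => mul_nonneg (hP.pos x).le (hP.hitMean_nonneg hb x)
  have hF0 : 0 ≤ F := Finset.sum_nonneg fun j _ => hP.weight_nonneg j
  have hF1 : F ≤ 1 := hP.sum_range_weight_le_one b
  -- Cauchy–Schwarz, using that `h` vanishes from `b` on
  have hcs : M ^ 2 ≤ F * S := by
    have cs := Finset.sum_mul_sq_le_sq_mul_sq
      (Finset.univ.filter (fun x : Fin (m + 1) => (x : ℕ) < b))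
      (fun x => √(π x)) (fun x => √(π x) * h x)
    have e1 : ∑ x ∈ Finset.univ.filter (fun x : Fin (m + 1) => (x : ℕ) < b),
        √(π x) * (√(π x) * h x) = M := by
      rw [hM, Finset.sum_filter]
      refine Finset.sum_congr rfl fun x _ => ?_
      split_ifs with hx
      · rw [← mul_assoc, Real.mul_self_sqrt (hP.pos x).le]
      · rw [h0 x hx, mul_zero]
    have e2 : ∑ x ∈ Finset.univ.filter (fun x : Fin (m + 1) => (x : ℕ) < b),
        (√(π x) * h x) ^ 2 = S := by
      rw [hS, Finset.sum_filter]
      refine Finset.sum_congr rfl fun x _ => ?_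
      split_ifs with hx
      · rw [mul_pow, Real.sq_sqrt (hP.pos x).le, sq]
      · rw [h0 x hx, mul_zero, mul_zero]
    have e3 : ∑ x ∈ Finset.univ.filter (fun x : Fin (m + 1) => (x : ℕ) < b), √(π x) ^ 2 = F := by
      rw [hFsum]
      exact Finset.sum_congr rfl fun x _ => Real.sq_sqrt (hP.pos x).le
    rwa [e1, e2, e3] at cs
  have hpoin : γ * (S - M ^ 2) ≤ M := by
    have hc := hP.mulVec_const M
    have h1 := hP.poincare (f := h - fun _ => M) (by
      simp only [Pi.sub_apply, mul_sub, Finset.sum_sub_distrib, ← Finset.sum_mul, hP.sum_one]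
      linarith)
    rw [Matrix.mulVec_sub, hc] at h1
    simp only [Pi.sub_apply] at h1
    have e1 : ∑ x, π x * ((h x - M) * (h x - M)) = S - M ^ 2 := by
      calc _ = ∑ x, (π x * (h x * h x) - 2 * M * (π x * h x) + M ^ 2 * π x) :=
            Finset.sum_congr rfl fun x _ => by ring
        _ = _ := by
          rw [Finset.sum_add_distrib, Finset.sum_sub_distrib, ← Finset.mul_sum, ← Finset.mul_sum,
            hP.sum_one, ← hM, ← hS]
          ring
    have e2 : ∑ x, π x * ((h x - M) * (h x - M - ((P *ᵥ h) x - M))) = M := by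
      have e3 : ∑ x, π x * (M * (h x - (P *ᵥ h) x)) = 0 := by
        have := hP.mean_mulVec h
        calc _ = M * (∑ x, π x * h x - ∑ x, π x * (P *ᵥ h) x) := by
              rw [← Finset.sum_sub_distrib, Finset.mul_sum]
              exact Finset.sum_congr rfl fun x _ => by ring
          _ = 0 := by rw [this, sub_self, mul_zero]
      refine Eq.trans ?_ (sub_zero M)
      rw [← e3]
      conv_rhs => enter [1]; rw [hM]
      rw [← Finset.sum_sub_distrib]
      refine Finset.sum_congr rfl fun x _ => ?_
      have e4 : h x * (h x - (P *ᵥ h) x) = h x := by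
        by_cases hx : (x : ℕ) < b
        · have : (P *ᵥ h) x = h x - 1 := hP.sum_mul_hitMean hb x hx
          rw [this]
          ring
        · simp [h0 x hx]
      linear_combination π x * e4
    rwa [e1, e2] at h1
  rw [← hMsum]
  rcases hF0.eq_or_lt with hF' | hF'
  · have : M = 0 := by
      rw [← hF', zero_mul] at hcs
      nlinarith
    rw [this, mul_zero]
    exact hF0
  · rcases hM0.eq_or_lt with hM' | hM'
    · rw [← hM', mul_zero]; exact hF0
    · -- `γ M² (1 - F) ≤ γ F (S - M²) ≤ F M`
      have h1 : γ * (1 - F) * M * M ≤ F * M := by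
        nlinarith [mul_le_mul_of_nonneg_left hcs hγ.le, mul_le_mul_of_nonneg_left hpoin hF0]
      exact le_of_mul_le_mul_right h1 hM'

/-- If a quarter of the mass lies at or above `b`, then the variance of the hitting time of `b`
is at most a multiple of the relaxation time times its mean. -/
lemma hitVar_le {b : ℕ} (hb : b ≤ m) (hb4 : 1 / 4 ≤ 1 - ∑ j ∈ Finset.range b, weight π j)
    (x : ℕ) : hitVar P π b x ≤ 8 / spectralGap P * hitMean P π b x := by
  have hγ : 0 < spectralGap P := hP.spectralGap_pos
  rw [hitVar, hitMean, Finset.mul_sum]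
  refine Finset.sum_le_sum fun i hi => ?_
  have hib : i < b := (Finset.mem_Ico.1 hi).2
  have him : i < m := hib.trans_le hb
  have h1 := hP.sum_passageMean_mul_cumWeight_le (b := i + 1) (by lia)
  have h2 : 1 / 4 ≤ 1 - ∑ j ∈ Finset.range (i + 1), weight π j := by
    have := hP.sum_range_weight_mono (a := i + 1) (b := b) hib
    linarith
  rw [← cumWeight] at h1 h2
  set T := ∑ i ∈ Finset.range (i + 1), passageMean P π i * cumWeight π i with hT
  have hT0 : 0 ≤ T := Finset.sum_nonneg fun j hj =>
    mul_nonneg (hP.passageMean_pos (by have := Finset.mem_range.1 hj; lia)).le hP.cumWeight_pos.le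
  have h3 : spectralGap P * T ≤ 4 * cumWeight π i := by
    nlinarith [mul_nonneg hγ.le hT0]
  have h4 : 2 * ∑ j ∈ Finset.range i, cumWeight π j * passageMean P π j +
      cumWeight π i * passageMean P π i ≤ 2 * T := by
    rw [hT, Finset.sum_range_succ]
    have := mul_pos (hP.cumWeight_pos (i := i)) (hP.passageMean_pos him)
    simp only [mul_comm (cumWeight π _)] at this ⊢
    linarith
  have hc := mul_pos (hP.weight_pos him.le) (hP.upProb_pos him)
  have h5 := hP.weight_mul_upProb_mul_passageMean him
  rw [passageVar, div_le_iff₀ hc, mul_assoc, mul_comm (passageMean P π i), h5,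
    div_mul_eq_mul_div, le_div_iff₀ hγ]
  nlinarith

/-- Between two states that cut off fixed amounts of mass, the expected hitting time
is of the order of the relaxation time. -/
lemma hitMean_between_le {b : ℕ} (hb : b ≤ m)
    (hb4 : 1 / 4 ≤ 1 - ∑ j ∈ Finset.range b, weight π j) {c : ℕ} {ε : ℝ} (hε : 0 < ε)
    (hc : ε ≤ cumWeight π c) :
    hitMean P π b c ≤ 4 / (spectralGap P * ε) := by
  have hγ : 0 < spectralGap P := hP.spectralGap_pos
  have h1 := hP.sum_passageMean_mul_cumWeight_le hb
  set T := ∑ i ∈ Finset.range b, passageMean P π i * cumWeight π i with hT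
  have hpos : ∀ i ∈ Finset.range b, 0 ≤ passageMean P π i := fun i hi =>
    (hP.passageMean_pos ((Finset.mem_range.1 hi).trans_le hb)).le
  have hT0 : 0 ≤ T := Finset.sum_nonneg fun i hi => mul_nonneg (hpos i hi) hP.cumWeight_pos.le
  have h2 : ε * hitMean P π b c ≤ T := by
    rw [hitMean, Finset.mul_sum, hT]
    calc _ ≤ ∑ i ∈ Finset.Ico c b, passageMean P π i * cumWeight π i := by
          refine Finset.sum_le_sum fun i hi => ?_
          rw [mul_comm]
          refine mul_le_mul_of_nonneg_left (hc.trans ?_)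
            (hpos i (Finset.mem_range.2 (Finset.mem_Ico.1 hi).2))
          exact hP.sum_range_weight_mono (by have := (Finset.mem_Ico.1 hi).1; lia)
      _ ≤ _ := by
        refine Finset.sum_le_sum_of_subset_of_nonneg ?_ fun i hi _ =>
          mul_nonneg (hpos i hi) hP.cumWeight_pos.le
        exact fun i hi => Finset.mem_range.2 (Finset.mem_Ico.1 hi).2
  have h3 : spectralGap P * T ≤ 4 := by
    have := hP.sum_range_weight_le_one b
    nlinarith [mul_nonneg hγ.le hT0]
  rw [le_div_iff₀ (by positivity)]
  nlinarith

end IsErgodicBirthDeath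

end BirthDeathTails

section TotalVariation

variable {Ω : Type*} [Fintype Ω]

lemma sum_mul_sub_le_tvDist {μ ν f : Ω → ℝ} (hf : ∀ x, |f x| ≤ 1) :
    ∑ x, f x * (μ x - ν x) ≤ 2 * tvDist μ ν := by
  rw [tvDist, ← mul_assoc, mul_one_div_cancel two_ne_zero, one_mul]
  refine Finset.sum_le_sum fun x _ => (le_abs_self _).trans ?_
  rw [abs_mul]
  exact mul_le_of_le_one_left (abs_nonneg _) (hf x)

lemma exists_sum_mul_sub_eq_tvDist (μ ν : Ω → ℝ) :
    ∃ f : Ω → ℝ, (∀ x, |f x| ≤ 1) ∧ ∑ x, f x * (μ x - ν x) = 2 * tvDist μ ν := by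
  refine ⟨fun x => if 0 ≤ μ x - ν x then 1 else -1, fun x => by dsimp only; split_ifs <;> simp, ?_⟩
  rw [tvDist, ← mul_assoc, mul_one_div_cancel two_ne_zero, one_mul]
  refine Finset.sum_congr rfl fun x _ => ?_
  dsimp only
  split_ifs with h
  · rw [abs_of_nonneg h, one_mul]
  · rw [abs_of_neg (not_le.1 h), neg_one_mul]

lemma tvDist_le_worstDist [DecidableEq Ω] (P : Matrix Ω Ω ℝ) (π : Ω → ℝ) (t : ℕ) (x : Ω) :
    tvDist ((P ^ t) x) π ≤ worstDist P π t :=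
  le_ciSup (f := fun x => tvDist ((P ^ t) x) π) (Set.finite_range _).bddAbove x

end TotalVariation

section Mixing

variable {m : ℕ} {δ : ℝ} {P : Matrix (Fin (m + 1)) (Fin (m + 1)) ℝ} {π : Fin (m + 1) → ℝ}

/-- At least a quarter of the mass of `π` lies on each side of `b` (`b` included). -/
def IsMiddle (π : Fin (m + 1) → ℝ) (b : Fin (m + 1)) : Prop :=
  1 / 4 ≤ ∑ y ∈ Finset.Iic b, π y ∧ 1 / 4 ≤ ∑ y ∈ Finset.Ici b, π y

namespace IsErgodicBirthDeath

lemma cumWeight_eq (π : Fin (m + 1) → ℝ) (b : Fin (m + 1)) :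
    cumWeight π b = ∑ y ∈ Finset.Iic b, π y := by
  rw [cumWeight, ← sum_fin_filter_lt (m := m) (weight π) (by lia)]
  simp only [weight_val]
  congr 1
  ext y
  simp only [Finset.mem_filter, Finset.mem_univ, true_and, Finset.mem_Iic, Fin.le_def]
  lia

lemma one_sub_sum_weight_eq (hP : IsErgodicBirthDeath δ P π) (b : Fin (m + 1)) :
    1 - ∑ j ∈ Finset.range b, weight π j = ∑ y ∈ Finset.Ici b, π y := by
  rw [← sum_fin_filter_lt (m := m) (weight π) (by lia), ← hP.sum_one,
    ← Finset.sum_filter_add_sum_filter_not Finset.univ (fun x : Fin (m + 1) => (x : ℕ) < b)]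
  simp only [weight_val, add_sub_cancel_left]
  congr 1
  ext y
  simp only [Finset.mem_filter, Finset.mem_univ, true_and, Finset.mem_Ici, Fin.le_def, not_lt]

/-- Middle states carry at least half of the mass. -/
lemma exists_middle (hP : IsErgodicBirthDeath δ P π) (B : Finset (Fin (m + 1)))
    (hB : ∑ x ∈ B, π x ≤ 1 / 4) : ∃ b : Fin (m + 1), IsMiddle π b ∧ b ∉ B := by
  by_contra! hcon
  set L := Finset.univ.filter fun b : Fin (m + 1) => ∑ y ∈ Finset.Iic b, π y < 1 / 4 with hL
  set U := Finset.univ.filter fun b : Fin (m + 1) => ∑ y ∈ Finset.Ici b, π y < 1 / 4 with hU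
  have hLs : ∑ x ∈ L, π x ≤ 1 / 4 := by
    rcases L.eq_empty_or_nonempty with h | h
    · rw [h]; norm_num
    · have h1 := L.max'_mem h
      refine le_trans (Finset.sum_le_sum_of_subset_of_nonneg (fun x hx => ?_)
        fun y _ _ => (hP.pos y).le) (Finset.mem_filter.1 h1).2.le
      exact Finset.mem_Iic.2 (L.le_max' x hx)
  have hUs : ∑ x ∈ U, π x ≤ 1 / 4 := by
    rcases U.eq_empty_or_nonempty with h | h
    · rw [h]; norm_num
    · have h1 := U.min'_mem h
      refine le_trans (Finset.sum_le_sum_of_subset_of_nonneg (fun x hx => ?_)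
        fun y _ _ => (hP.pos y).le) (Finset.mem_filter.1 h1).2.le
      exact Finset.mem_Ici.2 (U.min'_le x hx)
  have hcover : Finset.univ ⊆ L ∪ U ∪ B := by
    intro x _
    by_contra hx
    simp only [hL, hU, Finset.mem_union, Finset.mem_filter, Finset.mem_univ, true_and, not_or,
      not_lt] at hx
    exact hx.2 (hcon x hx.1)
  have h1 : ∑ x, π x ≤ ∑ x ∈ L, π x + ∑ x ∈ U, π x + ∑ x ∈ B, π x := by
    have h2 := Finset.sum_union_inter (s₁ := L) (s₂ := U) (f := π)
    have h3 := Finset.sum_union_inter (s₁ := L ∪ U) (s₂ := B) (f := π)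
    have h4 : 0 ≤ ∑ x ∈ L ∩ U, π x := Finset.sum_nonneg fun x _ => (hP.pos x).le
    have h5 : 0 ≤ ∑ x ∈ (L ∪ U) ∩ B, π x := Finset.sum_nonneg fun x _ => (hP.pos x).le
    have h6 := Finset.sum_le_sum_of_subset_of_nonneg (f := π) hcover
      fun x _ _ => (hP.pos x).le
    linarith
  linarith [hP.sum_one]

/-- **Lower bound on the mixing time** in terms of expected hitting times from the endpoint `0`:
before the chain reaches the `ε`-quantile of `π`, it is far from equilibrium. -/
lemma hitMean_le_of_worstDist_le (hP : IsErgodicBirthDeath δ P π) {ε : ℝ} (hε : 0 < ε)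
    (hε4 : ε ≤ 1 / 4) {t : ℕ} (ht : worstDist P π t ≤ 1 - 2 * ε) {b : Fin (m + 1)}
    (hb : IsMiddle π b) :
    hitMean P π b 0 ≤ t + √(8 * hitMean P π b 0 / (spectralGap P * ε)) +
      4 / (spectralGap P * ε) := by
  have hγ : 0 < spectralGap P := hP.spectralGap_pos
  obtain ⟨hb1, hb2⟩ := hb
  rw [← cumWeight_eq] at hb1
  rw [← hP.one_sub_sum_weight_eq] at hb2
  have hbm : (b : ℕ) ≤ m := by lia
  -- the `ε`-quantile
  have hex : ∃ c, ε ≤ cumWeight π c := ⟨b, by linarith⟩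
  set c := Nat.find hex with hc
  have hc1 : ε ≤ cumWeight π c := Nat.find_spec hex
  have hcb : c ≤ b := Nat.find_min' hex (by linarith)
  have hc2 : ∑ j ∈ Finset.range c, weight π j ≤ ε := by
    rcases Nat.eq_zero_or_pos c with h | h
    · rw [h]; simpa using hε.le
    · have := Nat.find_min hex (m := c - 1) (by lia)
      rw [cumWeight, Nat.sub_add_cancel h] at this
      exact (not_le.1 this).le
  have hsplit : hitMean P π b 0 = hitMean P π c 0 + hitMean P π b c :=
    (Finset.sum_Ico_consecutive _ (Nat.zero_le c) hcb).symm
  have hbet := hP.hitMean_between_le hbm hb2 hε hc1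
  have hcle : hitMean P π c 0 ≤ hitMean P π b 0 := by
    rw [hsplit]
    linarith [hP.hitMean_nonneg hbm c]
  rcases le_or_gt (hitMean P π c 0) t with hT | hT
  · have := Real.sqrt_nonneg (8 * hitMean P π b 0 / (spectralGap P * ε))
    linarith
  have htail := hP.lower_tail (b := c) (by lia) t 0 hT.le
  set f : Fin (m + 1) → ℝ := fun y => if c ≤ (y : ℕ) then 1 else 0 with hf
  have hvar := hP.hitVar_le (b := c) (by lia) (by linarith) 0
  have hmass : ε ≤ ((P ^ t) *ᵥ f) 0 := by
    have h1 := sum_mul_sub_le_tvDist (μ := (P ^ t) 0) (ν := π) (f := fun y => 1 - 2 * f y)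
      (fun y => by simp only [hf]; split_ifs <;> norm_num)
    have h2 := tvDist_le_worstDist P π t 0
    have h3 : ∑ y, (P ^ t) 0 y = 1 := by
      have := congrFun (hP.pow_mulVec_const 1 t) 0
      simpa [Matrix.mulVec, dotProduct] using this
    have h4 : ∑ y, π y * f y = 1 - ∑ j ∈ Finset.range c, weight π j := by
      rw [← sum_fin_filter_lt (m := m) (weight π) (by lia), ← hP.sum_one, eq_sub_iff_add_eq,
        Finset.sum_filter, ← Finset.sum_add_distrib]
      refine Finset.sum_congr rfl fun y _ => ?_
      rw [weight_val]
      simp only [hf]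
      by_cases hy : c ≤ (y : ℕ)
      · simp [hy]
      · simp [hy, not_le.1 hy]
    have h5 : ∑ y, (1 - 2 * f y) * ((P ^ t) 0 y - π y) =
        2 * ∑ y, π y * f y - 2 * ((P ^ t) *ᵥ f) 0 := by
      rw [Matrix.mulVec, dotProduct]
      calc _ = ∑ y, ((P ^ t) 0 y - π y + 2 * (π y * f y) - 2 * ((P ^ t) 0 y * f y)) :=
            Finset.sum_congr rfl fun y _ => by ring
        _ = _ := by
          rw [Finset.sum_sub_distrib, Finset.sum_add_distrib, Finset.sum_sub_distrib, h3,
            hP.sum_one, ← Finset.mul_sum, ← Finset.mul_sum]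
          ring
    rw [h5, h4] at h1
    linarith
  have hfin : (hitMean P π c 0 - t) ^ 2 ≤ 8 * hitMean P π b 0 / (spectralGap P * ε) := by
    rw [Fin.val_zero, sub_self] at htail
    rw [le_div_iff₀ (by positivity)]
    have h1 : ε * (hitMean P π c 0 - t) ^ 2 ≤ 8 / spectralGap P * hitMean P π c 0 :=
      (mul_le_mul_of_nonneg_right hmass (sq_nonneg _)).trans (by linarith)
    rw [div_mul_eq_mul_div, le_div_iff₀ hγ] at h1
    linarith
  have := Real.le_sqrt_of_sq_le hfin
  linarith

/-- Propagation of a good bound from a state `b` to the states `x ≤ b`. -/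
lemma le_two_mul_of_subsolution (hP : IsErgodicBirthDeath δ P π) {b : Fin (m + 1)}
    (hb : IsMiddle π b) {G : ℕ → Fin (m + 1) → ℝ} {ε : ℝ} (hε : 0 < ε) {s : ℕ}
    (hG0 : ∀ y, G 0 y ≤ 1) (hGP : ∀ k y, G (k + 1) y ≤ ∑ z, P y z * G k z)
    (hGb : ∀ k ≤ s, G k b ≤ ε)
    (hs : hitMean P π b 0 + √(8 * hitMean P π b 0 / (spectralGap P * ε)) ≤ s)
    {x : Fin (m + 1)} (hx : x ≤ b) : G s x ≤ 2 * ε := by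
  have hγ : 0 < spectralGap P := hP.spectralGap_pos
  rcases hx.eq_or_lt with rfl | hxb
  · linarith [hGb s le_rfl]
  have hbm : (b : ℕ) ≤ m := by lia
  have hb0 : 0 < (b : ℕ) := by rw [Fin.lt_def] at hxb; lia
  have hpos : 0 < hitMean P π b 0 := by
    rw [hitMean_succ hb0]
    exact add_pos_of_pos_of_nonneg (hP.passageMean_pos (by lia)) (hP.hitMean_nonneg hbm _)
  have hquot : 0 < 8 * hitMean P π b 0 / (spectralGap P * ε) := by positivity
  have hsq := Real.sqrt_pos.2 hquot
  have hxle := hP.hitMean_antitone hbm x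
  have htail := hP.upper_tail hbm hε.le (N := s) hG0 hGP
    (fun k hk y hy => by rw [Fin.ext hy]; exact hGb k hk) le_rfl x hx
    (a := hitMean P π b x) (by linarith)
  rw [sub_self] at htail
  have hv := (hP.hitVar_antitone hbm x).trans
    (hP.hitVar_le hbm (by rw [hP.one_sub_sum_weight_eq]; exact hb.2) 0)
  have h1 : 8 * hitMean P π b 0 / (spectralGap P * ε) ≤ (s - hitMean P π b x) ^ 2 := by
    rw [← Real.sq_sqrt hquot.le]
    exact pow_le_pow_left₀ hsq.le (by linarith) 2
  have h2 : 8 / spectralGap P * hitMean P π b 0 =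
      ε * (8 * hitMean P π b 0 / (spectralGap P * ε)) := by field_simp
  by_contra! hcon
  have h3 : ε * (8 * hitMean P π b 0 / (spectralGap P * ε)) <
      (G s x - ε) * (8 * hitMean P π b 0 / (spectralGap P * ε)) :=
    mul_lt_mul_of_pos_right (by linarith) hquot
  have h4 := mul_le_mul_of_nonneg_left h1 (show 0 ≤ G s x - ε by linarith)
  linarith

end IsErgodicBirthDeath

end Mixing

/-! ### Reflection and the comparison of mixing times -/

section Reflection

variable {m : ℕ} {δ : ℝ} {P : Matrix (Fin (m + 1)) (Fin (m + 1)) ℝ} {π : Fin (m + 1) → ℝ}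

lemma sum_rev (f : Fin (m + 1) → ℝ) : ∑ x : Fin (m + 1), f x.rev = ∑ x, f x :=
  Equiv.sum_comp Fin.revPerm f

lemma mulVec_submatrix_rev (P : Matrix (Fin (m + 1)) (Fin (m + 1)) ℝ) (f : Fin (m + 1) → ℝ)
    (x : Fin (m + 1)) :
    (P.submatrix Fin.rev Fin.rev *ᵥ f) x = (P *ᵥ (f ∘ Fin.rev)) x.rev := by
  simp only [Matrix.mulVec, dotProduct, Matrix.submatrix_apply, Function.comp_apply]
  rw [← sum_rev]
  simp

lemma submatrix_rev_pow (P : Matrix (Fin (m + 1)) (Fin (m + 1)) ℝ) (t : ℕ) :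
    P.submatrix Fin.rev Fin.rev ^ t = (P ^ t).submatrix Fin.rev Fin.rev := by
  induction t with
  | zero =>
    ext x y
    simp [Matrix.one_apply]
  | succ t ih =>
    ext x y
    rw [pow_succ, ih, pow_succ, Matrix.submatrix_apply, Matrix.mul_apply, Matrix.mul_apply,
      ← sum_rev]
    simp

lemma worstDist_rev (P : Matrix (Fin (m + 1)) (Fin (m + 1)) ℝ) (π : Fin (m + 1) → ℝ) (t : ℕ) :
    worstDist (P.submatrix Fin.rev Fin.rev) (π ∘ Fin.rev) t = worstDist P π t := by
  rw [worstDist, worstDist, ← Equiv.iSup_comp Fin.revPerm]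
  congr 1
  ext x
  rw [submatrix_rev_pow, tvDist, tvDist, ← sum_rev]
  simp

lemma hasEigenvalue_of_submatrix_rev {μ : ℝ}
    (h : Module.End.HasEigenvalue (Matrix.toLin' (P.submatrix Fin.rev Fin.rev)) μ) :
    Module.End.HasEigenvalue (Matrix.toLin' P) μ := by
  obtain ⟨f, hf, hf0⟩ := h.exists_hasEigenvector
  rw [Module.End.mem_eigenspace_iff, Matrix.toLin'_apply] at hf
  refine Module.End.hasEigenvalue_of_hasEigenvector (x := f ∘ Fin.rev) ⟨?_, fun h0 => hf0 ?_⟩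
  · rw [Module.End.mem_eigenspace_iff, Matrix.toLin'_apply]
    ext x
    have := congrFun hf x.rev
    rwa [mulVec_submatrix_rev, Fin.rev_rev] at this
  · ext x
    simpa using congrFun h0 x.rev

lemma spectralGap_rev (P : Matrix (Fin (m + 1)) (Fin (m + 1)) ℝ) :
    spectralGap (P.submatrix Fin.rev Fin.rev) = spectralGap P := by
  have h : ∀ μ, Module.End.HasEigenvalue (Matrix.toLin' (P.submatrix Fin.rev Fin.rev)) μ ↔
      Module.End.HasEigenvalue (Matrix.toLin' P) μ := fun μ =>
    ⟨hasEigenvalue_of_submatrix_rev, fun h => hasEigenvalue_of_submatrix_rev (by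
      have : (P.submatrix Fin.rev Fin.rev).submatrix Fin.rev Fin.rev = P := by ext; simp
      rwa [this])⟩
  simp only [spectralGap, maxNontrivialEigenvalue, h]

/-- The reflected chain `x ↦ m - x`. It exchanges the roles of the two endpoints. -/
lemma IsErgodicBirthDeath.rev (hP : IsErgodicBirthDeath δ P π) :
    IsErgodicBirthDeath δ (P.submatrix Fin.rev Fin.rev) (π ∘ Fin.rev) := by
  have hrow : ∀ x, ∑ y, P.submatrix Fin.rev Fin.rev x y = 1 := fun x => by
    rw [← hP.row_sum x.rev, ← sum_rev]
    simp
  refine ⟨⟨hP.delta_pos, fun x y => hP.nonneg _ _, hrow, fun x => hP.lazy _, fun x => hP.pos _,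
    ?_, fun x y => hP.reversible _ _, ?_⟩, ⟨?_, ?_⟩, ?_⟩
  · rw [← hP.sum_one, ← sum_rev]
    simp
  · intro f hf x y
    have := hP.harmonic (f ∘ Fin.rev) (by
      ext z
      have := congrFun hf z.rev
      rwa [mulVec_submatrix_rev, Fin.rev_rev] at this) x.rev y.rev
    simpa using this
  · exact Matrix.mem_rowStochastic_iff_sum.2 ⟨fun x y => hP.nonneg _ _, hrow⟩
  · intro x y hxy
    refine hP.birthDeath.nearest_neighbour _ _ ?_
    simp only [Fin.val_rev]
    lia
  · intro x y hxy
    have h1 := hP.up_pos y.rev x.rev (by simp only [Fin.val_rev]; lia)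
    have h2 := hP.reversible x.rev y.rev
    have h3 := mul_pos (hP.pos y.rev) h1
    rw [← h2] at h3
    exact (mul_pos_iff_of_pos_left (hP.pos x.rev)).1 h3

lemma IsMiddle.rev {b : Fin (m + 1)} (hb : IsMiddle π b) : IsMiddle (π ∘ Fin.rev) b.rev := by
  have key : ∀ s t : Finset (Fin (m + 1)), (∀ y, y ∈ s ↔ y.rev ∈ t) →
      ∑ y ∈ s, (π ∘ Fin.rev) y = ∑ y ∈ t, π y := fun s t h =>
    Finset.sum_equiv Fin.revPerm (fun y => by simpa using h y) fun y _ => by simp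
  refine ⟨?_, ?_⟩
  · rw [key _ (Finset.Ici b) fun y => by simp only [Finset.mem_Iic, Finset.mem_Ici, Fin.le_rev_iff]]
    exact hb.2
  · rw [key _ (Finset.Iic b) fun y => by simp only [Finset.mem_Iic, Finset.mem_Ici, Fin.rev_le_iff]]
    exact hb.1

end Reflection

section Mixing

variable {m : ℕ} {δ : ℝ} {P : Matrix (Fin (m + 1)) (Fin (m + 1)) ℝ} {π : Fin (m + 1) → ℝ}

/-- The expected time to hit the middle state `b` from the endpoint `0` or, in the reflected
picture, from the endpoint `m`. -/
noncomputable def endpointHitMean (P : Matrix (Fin (m + 1)) (Fin (m + 1)) ℝ)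
    (π : Fin (m + 1) → ℝ) (b : Fin (m + 1)) : ℝ :=
  max (hitMean P π b 0)
    (hitMean (P.submatrix Fin.rev Fin.rev) (π ∘ Fin.rev) b.rev 0)

namespace IsErgodicBirthDeath

lemma endpointHitMean_le_of_worstDist_le (hP : IsErgodicBirthDeath δ P π) {ε : ℝ} (hε : 0 < ε)
    (hε4 : ε ≤ 1 / 4) {t : ℕ} (ht : worstDist P π t ≤ 1 - 2 * ε) {b : Fin (m + 1)}
    (hb : IsMiddle π b) :
    endpointHitMean P π b ≤ t + √(8 * endpointHitMean P π b / (spectralGap P * ε)) +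
      4 / (spectralGap P * ε) := by
  rcases max_choice (hitMean P π b 0)
    (hitMean (P.submatrix Fin.rev Fin.rev) (π ∘ Fin.rev) b.rev 0) with h | h
  · rw [endpointHitMean, h]
    exact hP.hitMean_le_of_worstDist_le hε hε4 ht hb
  · rw [endpointHitMean, h]
    have := hP.rev.hitMean_le_of_worstDist_le hε hε4 (t := t) (by rwa [worstDist_rev]) hb.rev
    rwa [spectralGap_rev] at this

lemma endpointHitMean_nonneg (hP : IsErgodicBirthDeath δ P π) (b : Fin (m + 1)) :
    0 ≤ endpointHitMean P π b :=
  (hP.hitMean_nonneg (by lia) 0).trans (le_max_left _ _)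

/-- **Upper bound on the mixing time.** By the maximal inequality, there is a middle state `b`
at which the tested function is equidistributed at all times from `r` on, up to the final time.
A chain started anywhere mixes once it has hit `b` and `r` more steps have passed. -/
lemma worstDist_le (hP : IsErgodicBirthDeath δ P π) {ε : ℝ} (hε : 0 < ε) {r s : ℕ}
    (hr : 12 / (δ * spectralGap P * ε ^ 2) ≤ r)
    (hs : ∀ b, IsMiddle π b →
      endpointHitMean P π b + √(8 * endpointHitMean P π b / (spectralGap P * ε)) ≤ s) :
    worstDist P π (s + r) ≤ 2 * ε := by
  have hγ : 0 < spectralGap P := hP.spectralGap_pos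
  have hδ := hP.delta_pos
  classical
  refine ciSup_le fun x => ?_
  obtain ⟨f, hf1, hf⟩ := exists_sum_mul_sub_eq_tvDist ((P ^ (s + r)) x) π
  set c := ∑ y, π y * f y with hc
  set g : Fin (m + 1) → ℝ := f - fun _ => c with hg
  have hg0 : ∑ y, π y * g y = 0 := by
    simp only [hg, Pi.sub_apply, mul_sub, Finset.sum_sub_distrib, ← Finset.sum_mul, hP.sum_one]
    linarith
  have hg2 : ∑ y, π y * (g y * g y) ≤ 1 := by
    have e : ∑ y, π y * (g y * g y) = ∑ y, π y * (f y * f y) - c ^ 2 := by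
      calc _ = ∑ y, (π y * (f y * f y) - 2 * c * (π y * f y) + c ^ 2 * π y) :=
            Finset.sum_congr rfl fun y _ => by simp only [hg, Pi.sub_apply]; ring
        _ = _ := by
          rw [Finset.sum_add_distrib, Finset.sum_sub_distrib, ← Finset.mul_sum, ← Finset.mul_sum,
            hP.sum_one, ← hc]
          ring
    have h1 : ∑ y, π y * (f y * f y) ≤ ∑ y, π y := by
      refine Finset.sum_le_sum fun y _ => mul_le_of_le_one_right (hP.pos y).le ?_
      rw [← sq, ← sq_abs]
      exact pow_le_one₀ (abs_nonneg _) (hf1 y)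
    rw [hP.sum_one] at h1
    linarith [sq_nonneg c]
  have hc1 : |c| ≤ 1 := by
    calc |c| ≤ ∑ y, |π y * f y| := Finset.abs_sum_le_sum_abs _ _
      _ ≤ ∑ y, π y := Finset.sum_le_sum fun y _ => by
        rw [abs_mul, abs_of_pos (hP.pos y)]
        exact mul_le_of_le_one_right (hP.pos y).le (hf1 y)
      _ = 1 := hP.sum_one
  have hgb : ∀ y, |g y| ≤ 2 := fun y => by
    have h1 := abs_le.1 (hf1 y)
    have h2 := abs_le.1 hc1
    simp only [hg, Pi.sub_apply]
    rw [abs_le]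
    constructor <;> linarith
  have htv : ((P ^ (s + r)) *ᵥ g) x = 2 * tvDist ((P ^ (s + r)) x) π := by
    rw [← hf, hg, Matrix.mulVec_sub, Pi.sub_apply, hP.pow_mulVec_const, hc, Matrix.mulVec,
      dotProduct, ← Finset.sum_sub_distrib]
    exact Finset.sum_congr rfl fun y _ => by ring
  -- the states at which `g` is not equidistributed at some time in `[r, s + r]`
  set B := Finset.univ.filter fun y =>
    ∃ u, r ≤ u ∧ u ≤ s + r ∧ ε < |((P ^ u) *ᵥ g) y| with hB
  have hBle : ∑ y ∈ B, π y ≤ 1 / 4 := by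
    refine (hP.measure_exists_large_le hg0 hg2 (Nat.le_add_left r s) hε B
      fun y hy => (Finset.mem_filter.1 hy).2).trans ?_
    rw [div_le_iff₀ (by positivity)] at hr ⊢
    nlinarith [mul_pos (mul_pos hδ hγ) (pow_pos hε 2)]
  obtain ⟨b, hb, hbB⟩ := hP.exists_middle B hBle
  have hgood : ∀ u, r ≤ u → u ≤ s + r → |((P ^ u) *ᵥ g) b| ≤ ε := by
    intro u h1 h2
    by_contra! h3
    exact hbB (Finset.mem_filter.2 ⟨Finset.mem_univ b, u, h1, h2, h3⟩)
  set G : ℕ → Fin (m + 1) → ℝ := fun k y => ((P ^ (k + r)) *ᵥ g) y / 2 with hG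
  have hG0 : ∀ y, G 0 y ≤ 1 := fun y => by
    have := (abs_le.1 (hP.abs_pow_mulVec_le hgb (0 + r) y)).2
    simp only [hG]
    linarith
  have hGP : ∀ k y, G (k + 1) y = ∑ z, P y z * G k z := fun k y => by
    simp only [hG]
    rw [Nat.add_right_comm, pow_succ', ← Matrix.mulVec_mulVec, Matrix.mulVec, dotProduct,
      Finset.sum_div]
    exact Finset.sum_congr rfl fun z _ => by ring
  have hGb : ∀ k ≤ s, G k b ≤ ε := fun k hk => by
    have := (abs_le.1 (hgood (k + r) (Nat.le_add_left r k) (by lia))).2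
    simp only [hG]
    linarith
  have hmono : ∀ h, h ≤ endpointHitMean P π b → h + √(8 * h / (spectralGap P * ε)) ≤ s := by
    intro h hh
    refine le_trans ?_ (hs b hb)
    gcongr
  have hfin : G s x ≤ 2 * ε := by
    rcases le_total x b with hx | hx
    · exact hP.le_two_mul_of_subsolution hb hε hG0 (fun k y => (hGP k y).le) hGb
        (hmono _ (le_max_left _ _)) hx
    · have := hP.rev.le_two_mul_of_subsolution hb.rev (G := fun k y => G k y.rev) hε
        (fun y => hG0 _) (fun k y => by
          rw [hGP, ← sum_rev]
          simp)
        (s := s) (fun k hk => by simpa using hGb k hk)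
        (by rw [spectralGap_rev]; exact hmono _ (le_max_right _ _)) (x := x.rev)
        (Fin.rev_le_rev.2 hx)
      simpa using this
  simp only [hG, htv] at hfin
  linarith

lemma one_le_relaxationTime (hP : IsErgodicBirthDeath δ P π) : 1 ≤ relaxationTime P :=
  (one_le_inv₀ hP.spectralGap_pos).2 IsErgodicReversible.spectralGap_le_one

/-- If the chain is `1 - 2ε` close to equilibrium at time `t`, then a further time of order
`√(t · t_rel) + t_rel` makes it `2ε` close. -/
lemma exists_worstDist_le_of_worstDist_le (hP : IsErgodicBirthDeath δ P π) {ε : ℝ} (hε : 0 < ε)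
    (hε4 : ε ≤ 1 / 4) {t : ℕ} (ht : worstDist P π t ≤ 1 - 2 * ε) :
    ∃ t' : ℕ, worstDist P π t' ≤ 2 * ε ∧
      t' ≤ t + (30 / ε + 12 / (δ * ε ^ 2)) * (√(t * relaxationTime P) + relaxationTime P) := by
  have hγ : 0 < spectralGap P := hP.spectralGap_pos
  have hδ := hP.delta_pos
  have hτ1 := hP.one_le_relaxationTime
  set τ := relaxationTime P with hτ
  have hτ0 : 0 < τ := by linarith
  have hγτ : spectralGap P = τ⁻¹ := by rw [hτ, relaxationTime, inv_inv]
  set R := √(t * τ) with hR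
  have hR0 : 0 ≤ R := Real.sqrt_nonneg _
  have ht0 : (0 : ℝ) ≤ t := Nat.cast_nonneg t
  have hR2 : R ^ 2 = t * τ := Real.sq_sqrt (by positivity)
  set κ := τ / ε with hκ
  have hκ0 : 0 < κ := by positivity
  have hκε : κ * ε = τ := by rw [hκ]; field_simp
  have hτκ : τ ≤ κ / 4 := by nlinarith
  have key : ∀ b, IsMiddle π b →
      endpointHitMean P π b + √(8 * endpointHitMean P π b / (spectralGap P * ε)) ≤
        t + 8 / ε * R + 28 * κ := by
    intro b hb
    have h1 := hP.endpointHitMean_le_of_worstDist_le hε hε4 ht hb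
    set h := endpointHitMean P π b
    have h0 : 0 ≤ h := hP.endpointHitMean_nonneg b
    have e1 : 8 * h / (spectralGap P * ε) = 8 * h * κ := by
      rw [hγτ, hκ]; field_simp
    have e2 : 4 / (spectralGap P * ε) = 4 * κ := by
      rw [hγτ, hκ]; field_simp
    rw [e1, e2] at h1
    rw [e1]
    set q := √(8 * h * κ)
    have hq0 : 0 ≤ q := Real.sqrt_nonneg _
    have hq2 : q ^ 2 = 8 * h * κ := Real.sq_sqrt (by positivity)
    have hq : q ≤ h / 2 + 4 * κ := abs_le_of_sq_le_sq (by nlinarith [sq_nonneg (h / 2 - 4 * κ)])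
      (by positivity) |> fun h => (le_abs_self q).trans h
    have hh : h ≤ 2 * t + 16 * κ := by linarith
    have hq' : q ≤ 4 / ε * R + 12 * κ := by
      refine (le_abs_self q).trans (abs_le_of_sq_le_sq ?_ (by positivity))
      have h3 : t * κ = R ^ 2 / ε := by rw [hR2, hκ]; ring
      have h4 : R ^ 2 / ε ≤ (R / ε) ^ 2 := by
        rw [div_pow]
        refine div_le_div_of_nonneg_left (sq_nonneg R) (by positivity) ?_
        nlinarith
      have h5 : 0 ≤ R / ε * κ := by positivity
      have e3 : 4 / ε * R = 4 * (R / ε) := by ring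
      rw [e3, hq2]
      nlinarith [mul_le_mul_of_nonneg_right hh hκ0.le]
    have e4 : 8 / ε * R = 2 * (4 / ε * R) := by ring
    linarith
  refine ⟨⌈t + 8 / ε * R + 28 * κ⌉₊ + ⌈12 / (δ * spectralGap P * ε ^ 2)⌉₊,
    hP.worstDist_le hε (Nat.le_ceil _) fun b hb => (key b hb).trans (Nat.le_ceil _), ?_⟩
  have hc1 := Nat.ceil_lt_add_one (show 0 ≤ t + 8 / ε * R + 28 * κ by positivity)
  have hc2 := Nat.ceil_lt_add_one (show 0 ≤ 12 / (δ * spectralGap P * ε ^ 2) by positivity)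
  have e5 : 12 / (δ * spectralGap P * ε ^ 2) = 12 / (δ * ε ^ 2) * τ := by
    rw [hγτ]; field_simp
  have e6 : κ = 1 / ε * τ := by rw [hκ]; ring
  rw [e5] at hc2
  push_cast
  rw [e5]
  have h7 : (0 : ℝ) ≤ 12 / (δ * ε ^ 2) * R := by positivity
  have h8 : 0 ≤ 1 / ε * R := by positivity
  have e7 : (30 / ε + 12 / (δ * ε ^ 2)) * (R + τ) =
      30 * (1 / ε * R) + 30 * (1 / ε * τ) + 12 / (δ * ε ^ 2) * R + 12 / (δ * ε ^ 2) * τ := by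
    ring
  have e8 : 8 / ε * R = 8 * (1 / ε * R) := by ring
  rw [e7, ← e6]
  linarith

/-- The chain converges to equilibrium, so that mixing times are attained. -/
lemma exists_worstDist_le (hP : IsErgodicBirthDeath δ P π) {ε : ℝ} (hε : 0 < ε) :
    ∃ t, worstDist P π t ≤ ε := by
  obtain ⟨M, hM⟩ := (Set.finite_range fun b : Fin (m + 1) => endpointHitMean P π b +
    √(8 * endpointHitMean P π b / (spectralGap P * (ε / 2)))).bddAbove
  refine ⟨⌈M⌉₊ + ⌈12 / (δ * spectralGap P * (ε / 2) ^ 2)⌉₊, ?_⟩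
  have := hP.worstDist_le (half_pos hε) (Nat.le_ceil _)
    fun b _ => (hM ⟨b, rfl⟩).trans (Nat.le_ceil M)
  linarith

end IsErgodicBirthDeath

end Mixing

/-! ### Cutoff -/

namespace IsErgodicBirthDeath

variable {m : ℕ} {δ : ℝ} {P : Matrix (Fin (m + 1)) (Fin (m + 1)) ℝ} {π : Fin (m + 1) → ℝ}

lemma worstDist_mixingTime_le (hP : IsErgodicBirthDeath δ P π) {ε : ℝ} (hε : 0 < ε) :
    worstDist P π (mixingTime P π ε) ≤ ε :=
  Nat.sInf_mem (s := {t : ℕ | worstDist P π t ≤ ε}) (hP.exists_worstDist_le hε)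

lemma mixingTime_anti (hP : IsErgodicBirthDeath δ P π) {ε ε' : ℝ} (hε : 0 < ε) (h : ε ≤ ε') :
    mixingTime P π ε' ≤ mixingTime P π ε :=
  Nat.sInf_le ((hP.worstDist_mixingTime_le hε).trans h)

/-- The mixing times at levels `ε` and `1 - ε` differ by `O(√(t_mix(1/4) t_rel) + t_rel)`, with
a constant that only depends on `δ` and `ε`. -/
lemma mixingTime_sub_le (hP : IsErgodicBirthDeath δ P π) {ε : ℝ} (hε : 0 < ε) (hε4 : ε ≤ 1 / 4) :
    (mixingTime P π ε : ℝ) - mixingTime P π (1 - ε) ≤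
      (30 / (ε / 2) + 12 / (δ * (ε / 2) ^ 2)) *
        (√(mixingTime P π (1 / 4) * relaxationTime P) + relaxationTime P) := by
  have hδ := hP.delta_pos
  obtain ⟨t', h1, h2⟩ := hP.exists_worstDist_le_of_worstDist_le (half_pos hε) (by linarith)
    (t := mixingTime P π (1 - ε))
    (by rw [mul_div_cancel₀ _ two_ne_zero]; exact hP.worstDist_mixingTime_le (by linarith))
  rw [mul_div_cancel₀ _ two_ne_zero] at h1
  have h3 : (mixingTime P π ε : ℝ) ≤ t' := by exact_mod_cast Nat.sInf_le h1
  have h4 : (mixingTime P π (1 - ε) : ℝ) ≤ mixingTime P π (1 / 4) := by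
    exact_mod_cast hP.mixingTime_anti (by norm_num) (by linarith)
  have hτ := hP.one_le_relaxationTime
  have h5 : √(mixingTime P π (1 - ε) * relaxationTime P) ≤
      √(mixingTime P π (1 / 4) * relaxationTime P) := by gcongr
  have h6 : (0 : ℝ) ≤ 30 / (ε / 2) + 12 / (δ * (ε / 2) ^ 2) := by positivity
  have h7 := mul_le_mul_of_nonneg_left (add_le_add_left h5 (relaxationTime P)) h6
  linarith

/-- An eigenfunction for a nontrivial eigenvalue has mean zero and decays at the rate of its
eigenvalue, which bounds the distance to equilibrium from below. -/
lemma abs_pow_le_worstDist (hP : IsErgodicBirthDeath δ P π) {μ : ℝ}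
    (hμ : Module.End.HasEigenvalue (Matrix.toLin' P) μ) (h1 : μ ≠ 1) (t : ℕ) :
    |μ| ^ t ≤ 2 * worstDist P π t := by
  obtain ⟨f, hf, hf0⟩ := hμ.exists_hasEigenvector
  rw [Module.End.mem_eigenspace_iff, Matrix.toLin'_apply] at hf
  have hmean : ∑ x, π x * f x = 0 := by
    have h2 := hP.mean_mulVec f
    rw [hf] at h2
    have h3 : ∑ x, π x * (μ • f) x = μ * ∑ x, π x * f x := by
      rw [Finset.mul_sum]
      exact Finset.sum_congr rfl fun x _ => by simp only [Pi.smul_apply, smul_eq_mul]; ring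
    rw [h3] at h2
    have h4 : (μ - 1) * ∑ x, π x * f x = 0 := by linarith
    exact (mul_eq_zero.1 h4).resolve_left (sub_ne_zero.2 h1)
  have hpow : (P ^ t) *ᵥ f = μ ^ t • f := by
    induction t with
    | zero => simp
    | succ t ih => rw [pow_succ', ← Matrix.mulVec_mulVec, ih, Matrix.mulVec_smul, hf, smul_smul,
        pow_succ]
  obtain ⟨x, hx⟩ := Finite.exists_max fun x => |f x|
  have hfx : 0 < |f x| := by
    obtain ⟨y, hy⟩ := Function.ne_iff.1 hf0
    exact lt_of_lt_of_le (abs_pos.2 hy) (hx y)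
  have hval : ∑ y, f y * ((P ^ t) x y - π y) = μ ^ t * f x := by
    have h2 := congrFun hpow x
    simp only [Matrix.mulVec, dotProduct, Pi.smul_apply, smul_eq_mul] at h2
    rw [← h2, ← sub_zero (∑ y, (P ^ t) x y * f y), ← hmean, ← Finset.sum_sub_distrib]
    exact Finset.sum_congr rfl fun y _ => by ring
  have hle : |μ| ^ t * |f x| ≤ 2 * worstDist P π t * |f x| := by
    rw [← abs_pow, ← abs_mul, ← hval]
    calc _ ≤ ∑ y, |f y * ((P ^ t) x y - π y)| := Finset.abs_sum_le_sum_abs _ _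
      _ ≤ ∑ y, |f x| * |(P ^ t) x y - π y| := Finset.sum_le_sum fun y _ => by
        rw [abs_mul]
        exact mul_le_mul_of_nonneg_right (hx y) (abs_nonneg _)
      _ = |f x| * (2 * tvDist ((P ^ t) x) π) := by
        rw [← Finset.mul_sum, tvDist]
        ring
      _ ≤ |f x| * (2 * worstDist P π t) := by
        have := tvDist_le_worstDist P π t x
        gcongr
      _ = _ := mul_comm _ _
  exact le_of_mul_le_mul_right hle hfx

lemma pow_delta_sub_le (hP : IsErgodicBirthDeath δ P π) (t : ℕ) (x : Fin (m + 1)) :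
    δ ^ t - 2 * worstDist P π t ≤ π x := by
  have hnn : ∀ t x y, 0 ≤ (P ^ t) x y := fun t x y => Matrix.pow_apply_nonneg hP.nonneg t x y
  have hdiag : δ ^ t ≤ (P ^ t) x x := by
    induction t with
    | zero => simp
    | succ t ih =>
      rw [pow_succ, pow_succ, Matrix.mul_apply]
      calc δ ^ t * δ ≤ (P ^ t) x x * P x x :=
            mul_le_mul ih (hP.lazy x) hP.delta_pos.le (hnn t x x)
        _ ≤ _ := Finset.single_le_sum (f := fun y => (P ^ t) x y * P y x)
          (fun y _ => mul_nonneg (hnn t x y) (hP.nonneg y x)) (Finset.mem_univ x)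
  have h1 : |(P ^ t) x x - π x| ≤ 2 * tvDist ((P ^ t) x) π := by
    rw [tvDist, ← mul_assoc, mul_one_div_cancel two_ne_zero, one_mul]
    exact Finset.single_le_sum (f := fun y => |(P ^ t) x y - π y|) (fun y _ => abs_nonneg _)
      (Finset.mem_univ x)
  have h2 := tvDist_le_worstDist P π t x
  have h3 := (abs_le.1 h1).2
  linarith

lemma tvDist_pow_zero (hP : IsErgodicBirthDeath δ P π) (x : Fin (m + 1)) :
    tvDist ((P ^ 0) x) π = 1 - π x := by
  have h1 : π x ≤ 1 := by
    rw [← hP.sum_one]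
    exact Finset.single_le_sum (fun y _ => (hP.pos y).le) (Finset.mem_univ x)
  have h2 : ∀ y, |(P ^ 0) x y - π y| = π y + if x = y then 1 - 2 * π x else 0 := by
    intro y
    rw [pow_zero, Matrix.one_apply]
    split_ifs with h
    · subst h
      rw [abs_of_nonneg (by linarith)]
      ring
    · rw [zero_sub, abs_neg, abs_of_pos (hP.pos y), add_zero]
  rw [tvDist, Finset.sum_congr rfl fun y _ => h2 y, Finset.sum_add_distrib, hP.sum_one]
  simp only [Finset.sum_ite_eq, Finset.mem_univ, if_true]
  ring

/-- Only the one-state chain has mixing time `0`. -/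
lemma mixingTime_eq_zero (hP : IsErgodicBirthDeath δ P π) (h : mixingTime P π (1 / 4) = 0) {ε : ℝ}
    (hε : 0 < ε) : mixingTime P π ε = 0 := by
  have h1 := hP.worstDist_mixingTime_le (ε := 1 / 4) (by norm_num)
  rw [h] at h1
  have h2 : ∀ x, 3 / 4 ≤ π x := fun x => by
    have := tvDist_le_worstDist P π 0 x
    rw [hP.tvDist_pow_zero] at this
    linarith
  have hm : m = 0 := by
    have h3 := Finset.sum_le_sum fun x (_ : x ∈ Finset.univ) => h2 x
    rw [hP.sum_one, Finset.sum_const, Finset.card_univ, Fintype.card_fin, nsmul_eq_mul] at h3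
    push_cast at h3
    have h4 : (m : ℝ) < 1 := by linarith
    exact Nat.lt_one_iff.1 (by exact_mod_cast h4)
  subst hm
  refine Nat.le_zero.1 (Nat.sInf_le (show worstDist P π 0 ≤ ε from ciSup_le fun x => ?_))
  have h5 := hP.sum_one
  rw [Fin.sum_univ_one] at h5
  have hx : x = 0 := Fin.ext (by lia)
  rw [hP.tvDist_pow_zero, hx, h5]
  linarith

/-- If the chain has a nontrivial eigenvalue close to `1`, it has not mixed before a time of the
order of the relaxation time. -/
lemma relaxationTime_le_of_worstDist_le (hP : IsErgodicBirthDeath δ P π)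
    (hγ2 : spectralGap P ≤ 1 / 2) {t : ℕ} {a : ℝ} (ha : 0 < a)
    (ht : 2 * worstDist P π t ≤ Real.exp (-a)) : relaxationTime P ≤ 2 * t / a := by
  have hγ : 0 < spectralGap P := hP.spectralGap_pos
  have hl : maxNontrivialEigenvalue P = 1 - spectralGap P := by rw [spectralGap]; ring
  obtain ⟨μ, hμ, hμ1, hμl⟩ := IsErgodicReversible.exists_eigenvalue_of_pos (P := P)
    (by rw [hl]; linarith)
  have h1 := (hP.abs_pow_le_worstDist hμ hμ1 t).trans ht
  rw [← hμl, hl] at h1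
  have h2 : Real.exp (-(2 * spectralGap P)) ≤ 1 - spectralGap P := by
    rw [Real.exp_neg, inv_le_comm₀ (Real.exp_pos _) (by linarith)]
    refine le_trans ?_ (Real.add_one_le_exp _)
    rw [inv_le_iff_one_le_mul₀ (by linarith)]
    nlinarith
  have h3 := (pow_le_pow_left₀ (Real.exp_pos _).le h2 t).trans h1
  rw [← Real.exp_nat_mul, Real.exp_le_exp] at h3
  rw [relaxationTime, inv_le_iff_one_le_mul₀ hγ, div_mul_eq_mul_div, le_div_iff₀ ha]
  linarith

end IsErgodicBirthDeath

section Family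

variable {δ : ℝ} {m : ℕ → ℕ} {P : ∀ n, Matrix (Fin (m n + 1)) (Fin (m n + 1)) ℝ}
  {π : ∀ n, Fin (m n + 1) → ℝ}

lemma eventually_relaxationTime_le
    (hP : ∀ n, IsErgodicBirthDeath δ (P n) (π n))
    (h : (fun n => relaxationTime (P n)) =o[atTop] fun n => (mixingTime (P n) (π n) (1 / 4) : ℝ))
    {c : ℝ} (hc : 0 < c) :
    ∀ᶠ n in atTop, relaxationTime (P n) ≤ c * mixingTime (P n) (π n) (1 / 4) := by
  filter_upwards [isLittleO_iff.1 h hc] with n hn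
  rwa [Real.norm_of_nonneg (zero_le_one.trans (hP n).one_le_relaxationTime),
    Real.norm_of_nonneg (Nat.cast_nonneg _)] at hn

lemma sqrt_isLittleO (hP : ∀ n, IsErgodicBirthDeath δ (P n) (π n))
    (h : (fun n => relaxationTime (P n)) =o[atTop]
      fun n => (mixingTime (P n) (π n) (1 / 4) : ℝ)) :
    (fun n => √((mixingTime (P n) (π n) (1 / 4) : ℝ) * relaxationTime (P n))) =o[atTop]
      fun n => (mixingTime (P n) (π n) (1 / 4) : ℝ) := by
  refine isLittleO_iff.2 fun c hc => ?_
  filter_upwards [eventually_relaxationTime_le hP h (pow_pos hc 2)] with n hn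
  have hT : (0 : ℝ) ≤ mixingTime (P n) (π n) (1 / 4) := Nat.cast_nonneg _
  rw [Real.norm_of_nonneg (Real.sqrt_nonneg _), Real.norm_of_nonneg hT]
  refine Real.sqrt_le_iff.2 ⟨by positivity, ?_⟩
  nlinarith

/-- The level below `1/4` used to bound the mixing times at levels `ε` and `1 - ε` at once. -/
lemma exists_level {ε : ℝ} (h0 : 0 < ε) (h1 : ε < 1) :
    ∃ η, 0 < η ∧ η ≤ 1 / 4 ∧ η ≤ ε ∧ η ≤ 1 - ε :=
  ⟨min (1 / 4) (min ε (1 - ε)), by simp [h0, h1], min_le_left _ _,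
    (min_le_right _ _).trans (min_le_left _ _), (min_le_right _ _).trans (min_le_right _ _)⟩

lemma exists_eventually_sub_le (hP : ∀ n, IsErgodicBirthDeath δ (P n) (π n))
    (h : (fun n => relaxationTime (P n)) =o[atTop]
      fun n => (mixingTime (P n) (π n) (1 / 4) : ℝ)) {η : ℝ} (h0 : 0 < η) (h1 : η ≤ 1 / 4) :
    ∃ C, 0 < C ∧ ∀ᶠ n in atTop,
      (mixingTime (P n) (π n) η : ℝ) - mixingTime (P n) (π n) (1 - η) ≤
        C * √((mixingTime (P n) (π n) (1 / 4) : ℝ) * relaxationTime (P n)) := by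
  have hδ := (hP 0).delta_pos
  refine ⟨(30 / (η / 2) + 12 / (δ * (η / 2) ^ 2)) * 2, by positivity, ?_⟩
  filter_upwards [eventually_relaxationTime_le hP h one_pos] with n hn
  have h2 := (hP n).mixingTime_sub_le h0 h1
  have hτ := (hP n).one_le_relaxationTime
  have h3 : relaxationTime (P n) ≤
      √((mixingTime (P n) (π n) (1 / 4) : ℝ) * relaxationTime (P n)) := by
    refine Real.le_sqrt_of_sq_le ?_
    nlinarith
  refine h2.trans ?_
  rw [mul_assoc, two_mul]
  gcongr

lemma tendsto_mixingTime_div (hP : ∀ n, IsErgodicBirthDeath δ (P n) (π n))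
    (h : (fun n => relaxationTime (P n)) =o[atTop]
      fun n => (mixingTime (P n) (π n) (1 / 4) : ℝ)) {ε : ℝ} (h0 : 0 < ε) (h1 : ε < 1) :
    Tendsto (fun n => (mixingTime (P n) (π n) ε : ℝ) / mixingTime (P n) (π n) (1 / 4))
      atTop (𝓝 1) := by
  obtain ⟨η, hη0, hη4, hη1, hη2⟩ := exists_level h0 h1
  obtain ⟨C, -, hC⟩ := exists_eventually_sub_le hP h hη0 hη4
  have hO : (fun n => (mixingTime (P n) (π n) ε : ℝ) - mixingTime (P n) (π n) (1 / 4)) =O[atTop]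
      fun n => √((mixingTime (P n) (π n) (1 / 4) : ℝ) * relaxationTime (P n)) := by
    refine IsBigO.of_bound C ?_
    filter_upwards [hC] with n hn
    rw [Real.norm_of_nonneg (Real.sqrt_nonneg _)]
    refine le_trans ?_ hn
    have e1 : (mixingTime (P n) (π n) ε : ℝ) ≤ mixingTime (P n) (π n) η := by
      exact_mod_cast (hP n).mixingTime_anti hη0 hη1
    have e2 : (mixingTime (P n) (π n) (1 - η) : ℝ) ≤ mixingTime (P n) (π n) ε := by
      exact_mod_cast (hP n).mixingTime_anti h0 (by linarith)
    have e3 : (mixingTime (P n) (π n) (1 / 4) : ℝ) ≤ mixingTime (P n) (π n) η := by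
      exact_mod_cast (hP n).mixingTime_anti hη0 hη4
    have e4 : (mixingTime (P n) (π n) (1 - η) : ℝ) ≤ mixingTime (P n) (π n) (1 / 4) := by
      exact_mod_cast (hP n).mixingTime_anti (by norm_num) (by linarith)
    rw [Real.norm_eq_abs, abs_le]
    constructor <;> linarith
  have h2 := ((hO.trans_isLittleO (sqrt_isLittleO hP h)).tendsto_div_nhds_zero).add_const 1
  rw [zero_add] at h2
  refine h2.congr' ?_
  filter_upwards [eventually_relaxationTime_le hP h one_pos] with n hn
  have hτ := (hP n).one_le_relaxationTime
  have hT : (mixingTime (P n) (π n) (1 / 4) : ℝ) ≠ 0 := by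
    intro h0
    rw [h0] at hn
    linarith
  field_simp
  ring

theorem hasCutoff_of_isLittleO (hP : ∀ n, IsErgodicBirthDeath δ (P n) (π n))
    (h : (fun n => relaxationTime (P n)) =o[atTop]
      fun n => (mixingTime (P n) (π n) (1 / 4) : ℝ)) : HasCutoff P π := by
  intro ε h0 h1
  have h2 := (tendsto_mixingTime_div hP h h0 h1).div
    (tendsto_mixingTime_div hP h (sub_pos.2 h1) (sub_lt_self 1 h0)) one_ne_zero
  rw [div_one] at h2
  refine h2.congr' ?_
  filter_upwards [eventually_relaxationTime_le hP h one_pos] with n hn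
  have hτ := (hP n).one_le_relaxationTime
  have hT : (mixingTime (P n) (π n) (1 / 4) : ℝ) ≠ 0 := by
    intro h0
    rw [h0] at hn
    linarith
  exact div_div_div_cancel_right₀ hT _ _

theorem isCutoffWindow_of_isLittleO (hP : ∀ n, IsErgodicBirthDeath δ (P n) (π n))
    (h : (fun n => relaxationTime (P n)) =o[atTop]
      fun n => (mixingTime (P n) (π n) (1 / 4) : ℝ)) :
    IsCutoffWindow P π fun n =>
      √((mixingTime (P n) (π n) (1 / 4) : ℝ) * relaxationTime (P n)) := by
  refine ⟨sqrt_isLittleO hP h, fun ε h0 h1 => ?_⟩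
  obtain ⟨η, hη0, hη4, hη1, hη2⟩ := exists_level h0 h1
  obtain ⟨C, hC0, hC⟩ := exists_eventually_sub_le hP h hη0 hη4
  obtain ⟨N, hN⟩ := eventually_atTop.1 hC
  set w : ℕ → ℝ := fun n => √((mixingTime (P n) (π n) (1 / 4) : ℝ) * relaxationTime (P n)) with hw
  set D : ℕ → ℝ := fun n =>
    (mixingTime (P n) (π n) ε : ℝ) - mixingTime (P n) (π n) (1 - ε) with hD
  have hw0 : ∀ n, 0 ≤ w n := fun n => Real.sqrt_nonneg _
  -- the finitely many exceptional members of the family enlarge the constant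
  have hS : 0 ≤ ∑ n ∈ Finset.range N, |D n| / w n :=
    Finset.sum_nonneg fun n _ => div_nonneg (abs_nonneg _) (hw0 n)
  refine ⟨C + ∑ n ∈ Finset.range N, |D n| / w n, by linarith, fun n => ?_⟩
  change D n ≤ _ * w n
  rcases le_or_gt N n with hn | hn
  · have e1 : (mixingTime (P n) (π n) ε : ℝ) ≤ mixingTime (P n) (π n) η := by
      exact_mod_cast (hP n).mixingTime_anti hη0 hη1
    have e2 : (mixingTime (P n) (π n) (1 - η) : ℝ) ≤ mixingTime (P n) (π n) (1 - ε) := by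
      exact_mod_cast (hP n).mixingTime_anti (by linarith) (by linarith)
    have e3 : D n ≤ C * w n := by
      refine le_trans ?_ (hN n hn)
      simp only [hD]
      linarith
    nlinarith [mul_nonneg hS (hw0 n)]
  · rcases (hw0 n).eq_or_lt with h2 | h2
    · have hτ := (hP n).one_le_relaxationTime
      have hT : mixingTime (P n) (π n) (1 / 4) = 0 := by
        have h3 := (Real.sqrt_eq_zero (by positivity)).1 h2.symm
        exact_mod_cast (mul_eq_zero.1 h3).resolve_right (by linarith)
      have h4 := (hP n).mixingTime_eq_zero hT h0
      rw [← h2, mul_zero]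
      simp only [hD, h4, Nat.cast_zero, zero_sub, Left.neg_nonpos_iff]
      exact Nat.cast_nonneg _
    · have h3 : |D n| / w n ≤ ∑ n ∈ Finset.range N, |D n| / w n :=
        Finset.single_le_sum (f := fun n => |D n| / w n)
          (fun n _ => div_nonneg (abs_nonneg _) (hw0 n)) (Finset.mem_range.2 hn)
      rw [div_le_iff₀ h2] at h3
      nlinarith [le_abs_self (D n), mul_pos hC0 h2]

/-- Under cutoff, the mixing times at complementary levels are eventually comparable. -/
lemma HasCutoff.eventually_le_two_mul (hcut : HasCutoff P π) {ε : ℝ} (h0 : 0 < ε) (h1 : ε < 1) :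
    ∀ᶠ n in atTop, 0 < mixingTime (P n) (π n) (1 - ε) ∧
      mixingTime (P n) (π n) ε ≤ 2 * mixingTime (P n) (π n) (1 - ε) := by
  have h := hcut ε h0 h1
  filter_upwards [h.eventually_lt_const one_lt_two, h.eventually_const_lt one_half_lt_one]
    with n hn1 hn2
  have hpos : 0 < mixingTime (P n) (π n) (1 - ε) := by
    refine Nat.pos_of_ne_zero fun h0 => ?_
    rw [h0, Nat.cast_zero, div_zero] at hn2
    norm_num at hn2
  refine ⟨hpos, ?_⟩
  rw [div_lt_iff₀ (by exact_mod_cast hpos)] at hn1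
  exact_mod_cast hn1.le

/-- If `t_mix` stayed bounded, then by laziness `π` would put a fixed mass on every
state, and the chain would be `1 - ε` close to equilibrium at time `0` for a small `ε`. -/
lemma HasCutoff.eventually_lt_mixingTime (hcut : HasCutoff P π)
    (hP : ∀ n, IsErgodicBirthDeath δ (P n) (π n)) (N : ℕ) :
    ∀ᶠ n in atTop, N < mixingTime (P n) (π n) (1 / 4) := by
  have hδ := (hP 0).delta_pos
  have hδ1 := (hP 0).delta_le_one
  set ε := δ ^ (2 * N) / 4 with hε
  have hpow : δ ^ (2 * N) ≤ 1 := pow_le_one₀ hδ.le hδ1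
  have hε0 : 0 < ε := by positivity
  have hε4 : ε ≤ 1 / 4 := by linarith
  filter_upwards [hcut.eventually_le_two_mul hε0 (by linarith)] with n hn
  obtain ⟨hn0, hn2⟩ := hn
  by_contra! hcon
  have h1 : mixingTime (P n) (π n) (1 - ε) ≤ mixingTime (P n) (π n) (1 / 4) :=
    (hP n).mixingTime_anti (by norm_num) (by linarith)
  have h2 : mixingTime (P n) (π n) ε ≤ 2 * N := by lia
  have h3 : δ ^ (2 * N) ≤ δ ^ mixingTime (P n) (π n) ε := pow_le_pow_of_le_one hδ.le hδ1 h2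
  have h4 := (hP n).worstDist_mixingTime_le hε0
  have h5 : worstDist (P n) (π n) 0 ≤ 1 - ε := ciSup_le fun x => by
    rw [(hP n).tvDist_pow_zero]
    have := (hP n).pow_delta_sub_le (mixingTime (P n) (π n) ε) x
    linarith
  have h6 : mixingTime (P n) (π n) (1 - ε) ≤ 0 := Nat.sInf_le h5
  lia

theorem HasCutoff.isLittleO (hcut : HasCutoff P π)
    (hP : ∀ n, IsErgodicBirthDeath δ (P n) (π n)) :
    (fun n => relaxationTime (P n)) =o[atTop]
      fun n => (mixingTime (P n) (π n) (1 / 4) : ℝ) := by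
  refine isLittleO_iff.2 fun c hc => ?_
  -- a level that is passed only after `4 / c` units of half the relaxation time
  set ε := Real.exp (-(4 / c)) / 4 with hε
  have hexp : Real.exp (-(4 / c)) ≤ 1 := Real.exp_le_one_iff.2 (by
    rw [Left.neg_nonpos_iff]; positivity)
  have hε0 : 0 < ε := by positivity
  filter_upwards [hcut.eventually_le_two_mul hε0 (by linarith),
    hcut.eventually_lt_mixingTime hP ⌈2 / c⌉₊] with n hn hN
  have hτ := (hP n).one_le_relaxationTime
  rw [Real.norm_of_nonneg (by linarith), Real.norm_of_nonneg (Nat.cast_nonneg _)]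
  rcases le_or_gt (spectralGap (P n)) (1 / 2) with hγ | hγ
  · have h1 := (hP n).worstDist_mixingTime_le hε0
    have h2 := (hP n).relaxationTime_le_of_worstDist_le hγ (t := mixingTime (P n) (π n) ε)
      (a := 4 / c) (by positivity) (by linarith)
    have h3 : mixingTime (P n) (π n) (1 - ε) ≤ mixingTime (P n) (π n) (1 / 4) :=
      (hP n).mixingTime_anti (by norm_num) (by linarith)
    have h4 : (mixingTime (P n) (π n) ε : ℝ) ≤ 2 * mixingTime (P n) (π n) (1 / 4) := by
      exact_mod_cast hn.2.trans (by lia)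
    calc _ ≤ 2 * (mixingTime (P n) (π n) ε : ℝ) / (4 / c) := h2
      _ = c / 2 * mixingTime (P n) (π n) ε := by field_simp; ring
      _ ≤ c / 2 * (2 * mixingTime (P n) (π n) (1 / 4)) := by gcongr
      _ = _ := by ring
  · have h1 : relaxationTime (P n) ≤ 2 := by
      rw [relaxationTime, inv_le_comm₀ (hP n).spectralGap_pos two_pos]
      linarith
    have h2 : 2 / c ≤ mixingTime (P n) (π n) (1 / 4) :=
      (Nat.le_ceil _).trans (by exact_mod_cast hN.le)
    rw [div_le_iff₀ hc] at h2
    linarith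

end Family

end MarkovCutoff

theorem theorem3p1 (δ : ℝ) (hδ : 0 < δ) (m : ℕ → ℕ)
    (P : ∀ n, Matrix (Fin (m n + 1)) (Fin (m n + 1)) ℝ)
    (π : ∀ n, Fin (m n + 1) → ℝ)
    (hbd : ∀ n, MarkovCutoff.IsBirthDeath (P n))
    (hirr : ∀ n, (P n).IsIrreducible)
    (hlazy : ∀ n, MarkovCutoff.IsLazy δ (P n))
    (hπ : ∀ n, MarkovCutoff.IsStationary (P n) (π n)) :
    (MarkovCutoff.HasCutoff P π ↔
      (fun n => MarkovCutoff.relaxationTime (P n)) =o[atTop]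
        fun n => (MarkovCutoff.mixingTime (P n) (π n) (1 / 4) : ℝ)) ∧
    (MarkovCutoff.HasCutoff P π →
      MarkovCutoff.IsCutoffWindow P π fun n =>
        Real.sqrt ((MarkovCutoff.mixingTime (P n) (π n) (1 / 4) : ℝ) *
          MarkovCutoff.relaxationTime (P n))) := by
  have hP : ∀ n, MarkovCutoff.IsErgodicBirthDeath δ (P n) (π n) := fun n =>
    (hbd n).isErgodicBirthDeath hδ (hirr n) (hlazy n) (hπ n)
  exact ⟨⟨fun h => h.isLittleO hP, MarkovCutoff.hasCutoff_of_isLittleO hP⟩,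
    fun h => MarkovCutoff.isCutoffWindow_of_isLittleO hP (h.isLittleO hP)⟩
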